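/- **Setting.** Let $d\ge 1$ and let $\kappa(x,y)=f(\|x-y\|_2)$ be a stationary kernel on $\mathbb R^d$: $\kappa$ is positive definite (all kernel matrices are positive semi-definite) and $f$ is analytic at $0$. Write $f_i=f^{(i)}(0)/i!$, and let $r=\min\{j\ge 1: f_{2j-1}\ne 0\}\in\mathbb N^*\cup\{\infty\}$ be the smoothness order. Let $x_1,\dots,x_n\in\mathbb R^d$ and, for $\varepsilon>0$, $L_\varepsilon=[\kappa(\varepsilon x_i,\varepsilon x_j)]_{i,j=1}^n=[f(\varepsilon\|x_i-x_j\|_2)]_{i,j=1}^n$. Let $\mathscr P_{j,d}=\binom{j+d}{d}$ be the number of monomials in $d$ variables of degree at most $j$, with $\mathscr P_{-1,d}=0$. For a multi-index $\alpha$ let $x^\alpha$ be the corresponding monomial. Let $V_k=[x_i^\alpha]_{i,\,|\alpha|=k}$, $V_{\le k}=[x_i^\alpha]_{i,\,|\alpha|\le k}$ and $W_{\le k}=\big[\kappa^{(\alpha,\beta)}(0,0)/(\alpha!\,\beta!)\big]_{|\alpha|,|\beta|\le k}$ (the Wronskian matrix, with $\alpha$ the order of differentiation in the first and $\beta$ in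 the second argument). Partition $$W_{\le k}=\begin{bmatrix}W_{\le k-1}&W_{\urcorner}\\ W_{\llcorner}&W_{\lrcorner}\end{bmatrix},\qquad \bar W=W_{\lrcorner}-W_{\llcorner}W_{\le k-1}^{-1}W_{\urcorner}.$$ For a matrix $L\in\mathbb R^{n\times n}$, $|DPP|_m(L)$ is the random subset of $\{1,\dots,n\}$ with $\mathbb P(\mathcal X=X)=\mathbf 1_{|X|=m}\det L_X/\sum_{|Y|=m}\det L_Y$. For $V\in\mathbb R^{n\times p}$, $(L;V)$ is a nonnegative pair if $L$ is symmetric, $v^\top Lv\ge 0$ whenever $V^\top v=0$, and $V$ has full column rank. The fixed-size partial-projection DPP $|DPP|_m(L;V)$ is the random subset with $$\mathbb P(\mathcal X=X)\ \propto\ \mathbf 1_{|X|=m}\;w(X),\qquad w(X)=(-1)^p\det\begin{pmatrix}L_X&V_{X,:}\\ V_{X,:}^\top&0\end{pmatrix};$$ it is well defined when its normalisation constant $Z=\sum_{|Y|=m}w(Y)$ is nonzero. (For $p=0$ it is $|DPP|_m(L)$.) **Theorem.** Let $1\le m\le\mathscr P_{r-1,d}$ (no upper bound if $r=\infty$), and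 let $k\le r-1$ be the integer with $\mathscr P_{k-1,d}<m\le\mathscr P_{k,d}$. Assume that $W_{\le k-1}$ is invertible and that $V_{\le k-1}$ has full column rank. Then: 1. $(V_k\bar WV_k^\top;\,V_{\le k-1})$ is a nonnegative pair. 2. If $W_{\le k}$ is invertible and $\operatorname{rank}V_{\le k}\ge m$, then $|DPP|_m(V_k\bar WV_k^\top;\,V_{\le k-1})$ is well defined, i.e. its normalisation constant is nonzero. 3. Whenever that normalisation constant is nonzero, $|DPP|_m(V_k\bar WV_k^\top;V_{\le k-1})$ is a probability distribution, $|DPP|_m(L_\varepsilon)$ is a probability distribution for all sufficiently small $\varepsilon>0$, and as $\varepsilon\to0^+$ the process $\mathcal X_\varepsilon\sim|DPP|_m(L_\varepsilon)$ converges to $\mathcal X_\star\sim|DPP|_m(V_k\bar WV_k^\top;\,V_{\le k-1})$: $\mathbb P(\mathcal X_\varepsilon=X)\to\mathbb P(\mathcal X_\star=X)$ for every $X\subseteq\{1,\dots,n\}$. -/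

import Mathlib

open Filter Topology

noncomputable section

namespace FlatLimit

/-! ### Stationary kernels and their smoothness order -/

/-- A function of two points is positive definite if every kernel matrix that it generates is
symmetric positive semi-definite. -/
def IsPosDefKernel {E : Type*} (κ : E → E → ℝ) : Prop :=
  ∀ (N : ℕ) (z : Fin N → E), (Matrix.of fun i j => κ (z i) (z j)).PosSemidef

/-- `κ (x, y) = f (‖x - y‖)` is a stationary kernel on `ℝ^d`: it is positive definite and the
radial profile `f` is analytic at `0`. -/
structure IsStationaryKernel {d : ℕ}
    (κ : EuclideanSpace ℝ (Fin d) → EuclideanSpace ℝ (Fin d) → ℝ) (f : ℝ → ℝ) : Prop where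
  eq_radial : ∀ x y, κ x y = f ‖x - y‖
  posDef : IsPosDefKernel κ
  analytic : AnalyticAt ℝ f 0

/-- The Taylor coefficient `f_i = f^{(i)}(0) / i!`. -/
def taylorCoeff (f : ℝ → ℝ) (i : ℕ) : ℝ := iteratedDeriv i f 0 / (i.factorial : ℝ)

/-- The smoothness order `r = min {j ≥ 1 | f_{2j-1} ≠ 0}`, equal to `⊤` if every odd Taylor
coefficient vanishes. -/
def smoothnessOrder (f : ℝ → ℝ) : ℕ∞ :=
  sInf {r : ℕ∞ | ∃ j : ℕ, 1 ≤ j ∧ taylorCoeff f (2 * j - 1) ≠ 0 ∧ r = (j : ℕ∞)}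

/-- The kernel matrix `L_ε = [κ (ε x_i, ε x_j)]`. -/
def kernelMatrix {d n : ℕ} (κ : EuclideanSpace ℝ (Fin d) → EuclideanSpace ℝ (Fin d) → ℝ)
    (x : Fin n → EuclideanSpace ℝ (Fin d)) (ε : ℝ) : Matrix (Fin n) (Fin n) ℝ :=
  Matrix.of fun i j => κ (ε • x i) (ε • x j)

/-! ### Multi-indices, Vandermonde matrices -/

/-- The number of monomials in `d ≥ 1` variables of degree `< k`. In terms of the dimension
`P_{j,d} = binom (j + d, d)` of the polynomials of degree `≤ j`, this is `P_{k-1,d}`, with the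
convention `P_{-1,d} = 0`. -/
def polyDimLT (d : ℕ) : ℕ → ℕ
  | 0 => 0
  | j + 1 => (j + d).choose d

/-- Multi-indices of total degree `< k`. -/
abbrev MultiLT (d k : ℕ) : Type := {α : Fin d → ℕ // ∑ i, α i < k}

/-- Multi-indices of total degree exactly `k`. -/
abbrev MultiEq (d k : ℕ) : Type := {α : Fin d → ℕ // ∑ i, α i = k}

theorem finite_multi (d k : ℕ) : {α : Fin d → ℕ | ∑ i, α i ≤ k}.Finite :=
  (Set.finite_Iic (fun _ : Fin d => k)).subset fun _ hα i =>
    (Finset.single_le_sum (fun _ _ => Nat.zero_le _) (Finset.mem_univ i)).trans hα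

instance instFintypeMultiLT (d k : ℕ) : Fintype (MultiLT d k) :=
  ((finite_multi d k).subset
    (fun α (h : ∑ i, α i < k) => h.le : {α : Fin d → ℕ | ∑ i, α i < k} ⊆ _)).fintype

instance instFintypeMultiEq (d k : ℕ) : Fintype (MultiEq d k) :=
  ((finite_multi d k).subset
    (fun α (h : ∑ i, α i = k) => h.le : {α : Fin d → ℕ | ∑ i, α i = k} ⊆ _)).fintype

/-- All monomials evaluated at all points: the entry `(i, α)` is `x_i ^ α`. -/
def vandermonde {d n : ℕ} (x : Fin n → EuclideanSpace ℝ (Fin d)) :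
    Matrix (Fin n) (Fin d → ℕ) ℝ :=
  Matrix.of fun i α => ∏ j, x i j ^ α j

/-- `V_{≤ k-1}`: monomials of degree `< k` (no column if `k = 0`). -/
def vandermondeLT {d n : ℕ} (x : Fin n → EuclideanSpace ℝ (Fin d)) (k : ℕ) :
    Matrix (Fin n) (MultiLT d k) ℝ :=
  (vandermonde x).submatrix id Subtype.val

/-- `V_k`: monomials of degree exactly `k`. -/
def vandermondeEq {d n : ℕ} (x : Fin n → EuclideanSpace ℝ (Fin d)) (k : ℕ) :
    Matrix (Fin n) (MultiEq d k) ℝ :=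
  (vandermonde x).submatrix id Subtype.val

/-! ### The Wronskian matrix of a kernel -/

/-- The partial derivative `∂g/∂x_i`. -/
def partialDeriv {d : ℕ} (i : Fin d) (g : EuclideanSpace ℝ (Fin d) → ℝ) :
    EuclideanSpace ℝ (Fin d) → ℝ :=
  fun x => lineDeriv ℝ g x (EuclideanSpace.single i 1)

/-- The higher partial derivative `g^{(α)} = ∂^{|α|} g / ∂x_1^{α_1} ⋯ ∂x_d^{α_d}`. -/
def multiDeriv {d : ℕ} (α : Fin d → ℕ) (g : EuclideanSpace ℝ (Fin d) → ℝ) :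
    EuclideanSpace ℝ (Fin d) → ℝ :=
  (List.finRange d).foldr (fun i h => (partialDeriv i)^[α i] h) g

/-- The Wronskian: the entry `(α, β)` is `κ^{(α,β)}(0,0) / (α! β!)`, the derivative being of order
`α` in the first and of order `β` in the second argument. -/
def wronskian {d : ℕ} (κ : EuclideanSpace ℝ (Fin d) → EuclideanSpace ℝ (Fin d) → ℝ) :
    Matrix (Fin d → ℕ) (Fin d → ℕ) ℝ :=
  Matrix.of fun α β =>
    multiDeriv α (fun x => multiDeriv β (fun y => κ x y) 0) 0 /
      ((∏ i, ((α i).factorial : ℝ)) * ∏ i, ((β i).factorial : ℝ))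

/-- `W_{≤ k-1}`: rows and columns of degree `< k`; the top-left block of `W_{≤ k}`. -/
def wronskianLT {d : ℕ} (κ : EuclideanSpace ℝ (Fin d) → EuclideanSpace ℝ (Fin d) → ℝ) (k : ℕ) :
    Matrix (MultiLT d k) (MultiLT d k) ℝ :=
  (wronskian κ).submatrix Subtype.val Subtype.val

/-- The top-right block of `W_{≤ k}`: rows of degree `< k`, columns of degree `k`. -/
def wronskianTopRight {d : ℕ}
    (κ : EuclideanSpace ℝ (Fin d) → EuclideanSpace ℝ (Fin d) → ℝ) (k : ℕ) :
    Matrix (MultiLT d k) (MultiEq d k) ℝ :=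
  (wronskian κ).submatrix Subtype.val Subtype.val

/-- The bottom-left block of `W_{≤ k}`: rows of degree `k`, columns of degree `< k`. -/
def wronskianBottomLeft {d : ℕ}
    (κ : EuclideanSpace ℝ (Fin d) → EuclideanSpace ℝ (Fin d) → ℝ) (k : ℕ) :
    Matrix (MultiEq d k) (MultiLT d k) ℝ :=
  (wronskian κ).submatrix Subtype.val Subtype.val

/-- The bottom-right block of `W_{≤ k}`: rows and columns of degree `k`. -/
def wronskianBottomRight {d : ℕ}
    (κ : EuclideanSpace ℝ (Fin d) → EuclideanSpace ℝ (Fin d) → ℝ) (k : ℕ) :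
    Matrix (MultiEq d k) (MultiEq d k) ℝ :=
  (wronskian κ).submatrix Subtype.val Subtype.val

/-- The Schur complement of the block `W_{≤ k-1}` in `W_{≤ k}`. -/
def wronskianSchur {d : ℕ} (κ : EuclideanSpace ℝ (Fin d) → EuclideanSpace ℝ (Fin d) → ℝ) (k : ℕ) :
    Matrix (MultiEq d k) (MultiEq d k) ℝ :=
  wronskianBottomRight κ k -
    wronskianBottomLeft κ k * (wronskianLT κ k)⁻¹ * wronskianTopRight κ k

/-- The matrix `V_k W̄ V_kᵀ`. -/
def limitMatrix {d n : ℕ} (κ : EuclideanSpace ℝ (Fin d) → EuclideanSpace ℝ (Fin d) → ℝ)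
    (x : Fin n → EuclideanSpace ℝ (Fin d)) (k : ℕ) : Matrix (Fin n) (Fin n) ℝ :=
  vandermondeEq x k * wronskianSchur κ k * (vandermondeEq x k).transpose

/-! ### Fixed-size point processes on the ground set `{1, …, n}`

A point process is described by its probability mass function `X ↦ ℙ(𝒳 = X)` on the subsets. -/

/-- `p` is the probability mass function of a random subset. -/
def IsPointProcessLaw {n : ℕ} (p : Finset (Fin n) → ℝ) : Prop :=
  (∀ X, 0 ≤ p X) ∧ ∑ X, p X = 1

/-- The principal minor `det L_X`. -/
def principalMinor {n : ℕ} (L : Matrix (Fin n) (Fin n) ℝ) (X : Finset (Fin n)) : ℝ :=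
  (L.submatrix (Subtype.val : X → Fin n) (Subtype.val : X → Fin n)).det

/-- The probability mass function of the fixed-size L-ensemble `|DPP|_m(L)`. -/
def fixedSizeLaw {n : ℕ} (L : Matrix (Fin n) (Fin n) ℝ) (m : ℕ) (X : Finset (Fin n)) : ℝ :=
  if X.card = m then
    principalMinor L X / ∑ Y ∈ Finset.univ.powersetCard m, principalMinor L Y
  else 0

/-- `(L; V)` is a nonnegative pair: `L` is symmetric and conditionally positive semi-definite with
respect to `V`, and `V` has full column rank. -/
structure IsNonnegativePair {n : ℕ} {P : Type*} (L : Matrix (Fin n) (Fin n) ℝ)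
    (V : Matrix (Fin n) P ℝ) : Prop where
  symm : L.IsSymm
  condPosSemidef : ∀ v : Fin n → ℝ, V.transpose.mulVec v = 0 → 0 ≤ v ⬝ᵥ L.mulVec v
  fullColumnRank : LinearIndependent ℝ V.col

/-- The unnormalised mass `(-1)^p det [[L_X, V_X], [V_Xᵀ, 0]]` of the extended L-ensemble based on
`(L; V)`, where `p` is the number of columns of `V`. -/
def extendedWeight {n : ℕ} {P : Type*} [Fintype P] [DecidableEq P]
    (L : Matrix (Fin n) (Fin n) ℝ) (V : Matrix (Fin n) P ℝ) (X : Finset (Fin n)) : ℝ :=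
  (-1) ^ Fintype.card P *
    (Matrix.fromBlocks
      (L.submatrix (Subtype.val : X → Fin n) (Subtype.val : X → Fin n))
      (V.submatrix (Subtype.val : X → Fin n) id)
      (V.submatrix (Subtype.val : X → Fin n) id).transpose
      (0 : Matrix P P ℝ)).det

/-- The normalisation constant of the extended L-ensemble of fixed size `m`. -/
def extendedNormaliser {n : ℕ} {P : Type*} [Fintype P] [DecidableEq P]
    (L : Matrix (Fin n) (Fin n) ℝ) (V : Matrix (Fin n) P ℝ) (m : ℕ) : ℝ :=
  ∑ Y ∈ Finset.univ.powersetCard m, extendedWeight L V Y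

/-- The probability mass function of the fixed-size partial-projection DPP `|DPP|_m(L; V)`. -/
def fixedSizeExtendedLaw {n : ℕ} {P : Type*} [Fintype P] [DecidableEq P]
    (L : Matrix (Fin n) (Fin n) ℝ) (V : Matrix (Fin n) P ℝ) (m : ℕ) (X : Finset (Fin n)) : ℝ :=
  if X.card = m then extendedWeight L V X / extendedNormaliser L V m else 0

end FlatLimit

end

open FlatLimit

namespace FlatLimit

/-! Since `k` is below the smoothness order, the odd Taylor terms of degree below `2k + 1` vanish,
so `f(‖x - y‖)` is a polynomial `Q(x, y)` of total degree at most `2k` plus `‖x - y‖^(2k+1) F(‖x -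
y‖)`. The Wronskian entries with `|α| + |β| ≤ 2k` are the coefficients of `Q`
(`wronskian_eq_biCoeff`). With `A = V_{≤k-1}`, `B = V_k` and `D = diag(ε^|α|)`, sorting monomials by
degree (`exists_kernelMatrix_expansion`) gives `L_ε = A D W D Aᵀ`, plus cross terms of the form `ε^k
A D U` and `ε^k U' D Aᵀ`, plus `ε^(2k) (B W_⌟ Bᵀ + O(ε))`.

Let `E = diag(ε^(k-|α|))`, so that `D E = ε^k` and `E → 0`. Completing the square and reading a
Schur complement backwards (`det_scaled_perturbation`) turns each principal minor into a bordered
determinant whose lower right block is `-E W⁻¹ E`. As `ε → 0` the borders tend to `A_X`, `A_Xᵀ` and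
the upper left block to `(B W̄ Bᵀ)_X`. Hence `det (L_ε)_X`, times a factor depending on `X` only
through its size, tends to `det W · w(X)` (`tendsto_principalMinor_kernelMatrix`). At fixed size the
factor cancels in the ratio of weight to normaliser, which is the claimed convergence.

Positivity also comes from the kernel: tested on vectors dual to the monomials, `L_ε` shows that the
Wronskian is positive semi-definite (`posSemidef_wronskian_blocks`), hence so is `W̄`, and the
weights are limits of nonnegative quantities. When `W_{≤k}` is invertible `W̄` is definite, and a
suitable choice of `m` rows (`exists_row_selection`) has positive weight. -/

variable {d : ℕ}

/-! ### Remainders of radial type and their partial derivatives -/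

/-- Functions that near the origin behave like a remainder of order `s`: finite sums of terms
`c x^γ ‖x‖^a h(‖x‖)` with `h` analytic at `0` and `|γ| + a = s`. -/
inductive IsRadialRemainder : ℤ → (EuclideanSpace ℝ (Fin d) → ℝ) → Prop
  | radial (a : ℤ) (h : ℝ → ℝ) (hh : AnalyticAt ℝ h 0) :
      IsRadialRemainder a fun x => ‖x‖ ^ a * h ‖x‖
  | coord (i : Fin d) {s : ℤ} {g : EuclideanSpace ℝ (Fin d) → ℝ} (hg : IsRadialRemainder s g) :
      IsRadialRemainder (s + 1) fun x => x i * g x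
  | add {s : ℤ} {g g' : EuclideanSpace ℝ (Fin d) → ℝ} (hg : IsRadialRemainder s g)
      (hg' : IsRadialRemainder s g') : IsRadialRemainder s fun x => g x + g' x
  | smul (c : ℝ) {s : ℤ} {g : EuclideanSpace ℝ (Fin d) → ℝ} (hg : IsRadialRemainder s g) :
      IsRadialRemainder s fun x => c * g x
  | congr {s : ℤ} {g g' : EuclideanSpace ℝ (Fin d) → ℝ} (hg : IsRadialRemainder s g)
      (h : g =ᶠ[𝓝 0] g') : IsRadialRemainder s g'

namespace IsRadialRemainder

theorem apply_zero {s : ℤ} {g : EuclideanSpace ℝ (Fin d) → ℝ} (hg : IsRadialRemainder s g)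
    (hs : 1 ≤ s) : g 0 = 0 := by
  induction hg with
  | radial a h hh => simp [zero_zpow a (by lia)]
  | coord i hg ih => simp
  | add hg hg' ih ih' => simp [ih hs, ih' hs]
  | smul c hg ih => simp [ih hs]
  | congr hg h ih => rw [← h.self_of_nhds, ih hs]

/-- The origin is excluded because the exponent of `‖x‖` may be negative, and `‖x‖ ^ a` then takes a
default value there. Away from it each coordinate factor is bounded by `‖x‖`. -/
theorem isBigO {s : ℤ} {g : EuclideanSpace ℝ (Fin d) → ℝ} (hg : IsRadialRemainder s g) :
    g =O[𝓝[≠] 0] fun x => ‖x‖ ^ s := by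
  induction hg with
  | radial a h hh =>
    have hc : Tendsto (fun x : EuclideanSpace ℝ (Fin d) => h ‖x‖) (𝓝[≠] 0) (𝓝 (h 0)) :=
      (hh.continuousAt.tendsto.comp tendsto_norm_zero).mono_left nhdsWithin_le_nhds
    simpa using (Asymptotics.isBigO_refl (fun x : EuclideanSpace ℝ (Fin d) => ‖x‖ ^ a)
      (𝓝[≠] 0)).mul (hc.isBigO_one ℝ)
  | coord i hg ih =>
    rename_i s g
    have h1 : (fun x : EuclideanSpace ℝ (Fin d) => x i) =O[𝓝[≠] 0] fun x => ‖x‖ :=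
      Asymptotics.IsBigO.of_bound 1 (Eventually.of_forall fun x => by
        simpa using PiLp.norm_apply_le x i)
    refine (h1.mul ih).congr' EventuallyEq.rfl ?_
    filter_upwards [self_mem_nhdsWithin] with x hx
    rw [zpow_add_one₀ (norm_ne_zero_iff.2 hx), mul_comm]
  | add hg hg' ih ih' => exact ih.add ih'
  | smul c hg ih => exact ih.const_mul_left c
  | congr hg h ih => exact ih.congr' (h.filter_mono nhdsWithin_le_nhds) EventuallyEq.rfl

theorem hasDerivAt_norm_line {x v : EuclideanSpace ℝ (Fin d)} (hx : x ≠ 0) :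
    HasDerivAt (fun t : ℝ => ‖x + t • v‖) (inner ℝ x v / ‖x‖) 0 := by
  have h1 : HasDerivAt (fun t : ℝ => x + t • v) v 0 := by
    simpa using ((hasDerivAt_id (0 : ℝ)).smul_const v).const_add x
  have h2 := h1.norm_sq.sqrt (by simpa using hx)
  simp only [zero_smul, add_zero, Real.sqrt_sq (norm_nonneg _)] at h2
  convert h2 using 1
  field_simp

/-- The class is stable under differentiation because `∂_i (‖x‖^a h(‖x‖)) = x_i ‖x‖^(a-2) (a h + ‖x‖
h')`, where the last bracket is again analytic in `‖x‖`. The exponent drops by two and one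
coordinate is gained; this is why exponents are integers. -/
theorem exists_hasLineDerivAt_punctured {s : ℤ} {g : EuclideanSpace ℝ (Fin d) → ℝ}
    (hg : IsRadialRemainder s g) (i : Fin d) :
    ∃ g', IsRadialRemainder (s - 1) g' ∧
      ∀ᶠ x in 𝓝[≠] 0, HasLineDerivAt ℝ g (g' x) x (EuclideanSpace.single i 1) := by
  induction hg with
  | radial a h hh =>
    refine ⟨fun x => x i * (‖x‖ ^ (a - 2) * (a * h ‖x‖ + ‖x‖ * deriv h ‖x‖)), ?_, ?_⟩
    · convert coord i (radial (a - 2) (fun t => a * h t + t * deriv h t) ?_) using 1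
      · ring
      · have := hh.deriv
        fun_prop
    · have hd : ∀ᶠ x : EuclideanSpace ℝ (Fin d) in 𝓝[≠] 0, DifferentiableAt ℝ h ‖x‖ :=
        (tendsto_norm_zero.eventually
          (hh.eventually_analyticAt.mono fun _ h => h.differentiableAt)).filter_mono
          nhdsWithin_le_nhds
      filter_upwards [hd, self_mem_nhdsWithin] with x hdx hx
      have hx0 : x ≠ 0 := hx
      have hn : ‖x‖ ≠ 0 := norm_ne_zero_iff.2 hx0
      have h1 := hasDerivAt_norm_line (v := EuclideanSpace.single i (1 : ℝ)) hx0
      have e : inner ℝ x (EuclideanSpace.single i (1 : ℝ)) = x i := by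
        simp [EuclideanSpace.inner_single_right]
      rw [e] at h1
      have h2 : HasDerivAt (fun t : ℝ => h ‖x + t • EuclideanSpace.single i (1 : ℝ)‖)
          (deriv h ‖x‖ * (x i / ‖x‖)) 0 := by
        refine HasDerivAt.comp (0 : ℝ) (h₂ := h) ?_ h1
        simpa using hdx.hasDerivAt
      have h3 : HasDerivAt (fun t : ℝ => ‖x + t • EuclideanSpace.single i (1 : ℝ)‖ ^ a)
          (a * ‖x‖ ^ (a - 1) * (x i / ‖x‖)) 0 := by
        refine HasDerivAt.comp (0 : ℝ) (h₂ := fun y : ℝ => y ^ a) ?_ h1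
        simpa using hasDerivAt_zpow a ‖x‖ (Or.inl hn)
      have h4 := h3.fun_mul h2
      simp only [zero_smul, add_zero] at h4
      refine HasDerivAt.congr_deriv (𝕜 := ℝ) h4 ?_
      rw [show a = (a - 2) + 1 + 1 by ring, zpow_add_one₀ hn, zpow_add_one₀ hn,
        show a - 2 + 1 + 1 - 1 = a - 2 + 1 by ring, zpow_add_one₀ hn,
        show a - 2 + 1 + 1 - 2 = a - 2 by ring]
      field_simp
  | coord j hg ih =>
    rename_i s g
    obtain ⟨g', hg', hd⟩ := ih
    have key : ∀ x : EuclideanSpace ℝ (Fin d), HasDerivAt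
        (fun t : ℝ => (x + t • EuclideanSpace.single i (1 : ℝ)) j) (if j = i then 1 else 0) 0 := by
      intro x
      have : HasDerivAt (fun t : ℝ => x j + t * (if j = i then 1 else 0))
          (if j = i then 1 else 0) 0 := by
        simpa using ((hasDerivAt_id (0 : ℝ)).mul_const (if j = i then (1 : ℝ) else 0)).const_add
          (x j)
      simpa [Pi.single_apply] using this
    refine ⟨fun x => (if j = i then 1 else 0) * g x + x j * g' x, ?_, ?_⟩
    · refine add (smul _ ?_) ?_
      · simpa using hg
      · simpa using coord j hg'
    · filter_upwards [hd] with x hx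
      have := HasDerivAt.fun_mul (𝕜 := ℝ) (key x) hx
      simp only [zero_smul, add_zero] at this
      exact this
  | add hg hg' ih ih' =>
    obtain ⟨u, hu, hd⟩ := ih
    obtain ⟨u', hu', hd'⟩ := ih'
    refine ⟨_, add hu hu', ?_⟩
    filter_upwards [hd, hd'] with x h h'
    exact HasDerivAt.add h h'
  | smul c hg ih =>
    obtain ⟨u, hu, hd⟩ := ih
    refine ⟨_, smul c hu, ?_⟩
    filter_upwards [hd] with x h
    exact HasDerivAt.const_mul c h
  | congr hg h ih =>
    obtain ⟨u, hu, hd⟩ := ih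
    refine ⟨u, hu, ?_⟩
    filter_upwards [hd, h.eventuallyEq_nhds.filter_mono nhdsWithin_le_nhds] with x hx hx'
    exact hx.congr_of_eventuallyEq hx'.symm

/-- From order two on, `g = O(‖x‖^s)` forces a zero Fréchet derivative at the origin. The remainder
of order `s - 1 ≥ 1` found off the origin also vanishes there, so the formula extends across it. -/
theorem exists_hasLineDerivAt {s : ℤ} {g : EuclideanSpace ℝ (Fin d) → ℝ}
    (hg : IsRadialRemainder s g) (hs : 2 ≤ s) (i : Fin d) :
    ∃ g', IsRadialRemainder (s - 1) g' ∧
      ∀ᶠ x in 𝓝 0, HasLineDerivAt ℝ g (g' x) x (EuclideanSpace.single i 1) := by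
  obtain ⟨g', hg', hd⟩ := hg.exists_hasLineDerivAt_punctured i
  refine ⟨g', hg', ?_⟩
  have h0 : HasLineDerivAt ℝ g (g' 0) 0 (EuclideanSpace.single i 1) := by
    rw [hg'.apply_zero (by lia)]
    have hO : g =O[𝓝 0] fun x => ‖x - 0‖ ^ s.toNat := by
      have := hg.isBigO
      rw [show 𝓝 (0 : EuclideanSpace ℝ (Fin d)) = 𝓝[≠] 0 ⊔ pure 0 by
        rw [sup_comm, pure_sup_nhdsNE]]
      refine Asymptotics.IsBigO.sup ?_ ?_
      · refine this.congr' EventuallyEq.rfl (Eventually.of_forall fun x => ?_)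
        simp only [sub_zero]
        rw [← zpow_natCast, Int.toNat_of_nonneg (by lia)]
      · refine Asymptotics.IsBigO.of_bound 1 ?_
        simp [hg.apply_zero (by lia)]
    have hF : HasFDerivAt g (0 : EuclideanSpace ℝ (Fin d) →L[ℝ] ℝ) 0 :=
      hO.hasFDerivAt (by lia)
    simpa using hF.hasLineDerivAt (EuclideanSpace.single i 1)
  rw [← nhdsNE_sup_pure, eventually_sup]
  exact ⟨hd, by simpa using h0⟩

end IsRadialRemainder

/-! ### Derivatives at the origin modulo a remainder -/

/-- `u` agrees near the origin with the smooth function `v` up to a remainder of order `s`. -/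
def ApproxAtZero (s : ℤ) (u v : EuclideanSpace ℝ (Fin d) → ℝ) : Prop :=
  ContDiff ℝ (⊤ : ℕ∞) v ∧ ∃ g, IsRadialRemainder s g ∧ u =ᶠ[𝓝 0] fun x => v x + g x

theorem partialDeriv_eq_fderiv {v : EuclideanSpace ℝ (Fin d) → ℝ} (hv : ContDiff ℝ (⊤ : ℕ∞) v)
    (i : Fin d) : partialDeriv i v = fun x => fderiv ℝ v x (EuclideanSpace.single i 1) :=
  funext fun x => (hv.differentiable (by simp) x).lineDeriv_eq_fderiv

theorem contDiff_partialDeriv {v : EuclideanSpace ℝ (Fin d) → ℝ} (hv : ContDiff ℝ (⊤ : ℕ∞) v)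
    (i : Fin d) : ContDiff ℝ (⊤ : ℕ∞) (partialDeriv i v) := by
  rw [partialDeriv_eq_fderiv hv]
  exact (hv.fderiv_right (m := (⊤ : ℕ∞)) (by simp)).clm_apply contDiff_const

namespace ApproxAtZero

theorem apply_zero {s : ℤ} {u v : EuclideanSpace ℝ (Fin d) → ℝ} (h : ApproxAtZero s u v)
    (hs : 1 ≤ s) : u 0 = v 0 := by
  obtain ⟨-, g, hg, e⟩ := h
  simpa [hg.apply_zero hs] using e.self_of_nhds

theorem const_mul {s : ℤ} {u v : EuclideanSpace ℝ (Fin d) → ℝ} (h : ApproxAtZero s u v) (c : ℝ) :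
    ApproxAtZero s (fun x => c * u x) fun x => c * v x := by
  obtain ⟨hv, g, hg, e⟩ := h
  exact ⟨contDiff_const.mul hv, _, hg.smul c, by filter_upwards [e] with x hx; rw [hx, mul_add]⟩

theorem partialDeriv {s : ℤ} {u v : EuclideanSpace ℝ (Fin d) → ℝ} (h : ApproxAtZero s u v)
    (hs : 2 ≤ s) (i : Fin d) :
    ApproxAtZero (s - 1) (partialDeriv i u) (FlatLimit.partialDeriv i v) := by
  obtain ⟨hv, g, hg, e⟩ := h
  obtain ⟨g', hg', hd⟩ := hg.exists_hasLineDerivAt hs i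
  refine ⟨contDiff_partialDeriv hv i, g', hg', ?_⟩
  filter_upwards [hd, e.eventuallyEq_nhds] with x hx hex
  have h1 : HasLineDerivAt ℝ v (FlatLimit.partialDeriv i v x) x (EuclideanSpace.single i 1) :=
    (hv.differentiable (by simp) x).lineDifferentiableAt.hasLineDerivAt
  exact (HasLineDerivAt.congr_of_eventuallyEq (f := fun x => v x + g x)
    (HasDerivAt.fun_add (𝕜 := ℝ) h1 hx) hex).lineDeriv

theorem iterate_partialDeriv {s : ℤ} {u v : EuclideanSpace ℝ (Fin d) → ℝ}
    (h : ApproxAtZero s u v) (i : Fin d) (a : ℕ) (hs : a + 1 ≤ s) :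
    ApproxAtZero (s - a) ((FlatLimit.partialDeriv i)^[a] u) ((FlatLimit.partialDeriv i)^[a] v) := by
  induction a with
  | zero => simpa using h
  | succ a ih =>
    simp only [Function.iterate_succ_apply']
    convert (ih (by push_cast at hs; lia)).partialDeriv (by push_cast at hs; lia) i using 1
    push_cast; ring

theorem foldr_partialDeriv {s : ℤ} {u v : EuclideanSpace ℝ (Fin d) → ℝ}
    (h : ApproxAtZero s u v) (α : Fin d → ℕ) (l : List (Fin d)) (hs : (l.map α).sum + 1 ≤ s) :
    ApproxAtZero (s - (l.map α).sum)
      (l.foldr (fun i h => (FlatLimit.partialDeriv i)^[α i] h) u)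
      (l.foldr (fun i h => (FlatLimit.partialDeriv i)^[α i] h) v) := by
  induction l with
  | nil => simpa using h
  | cons i l ih =>
    simp only [List.map_cons, List.sum_cons, List.foldr_cons] at hs ⊢
    rw [Nat.cast_add] at hs ⊢
    convert (ih (by lia)).iterate_partialDeriv i (α i) (by lia) using 1
    ring

/-- The bound `|α| + 1 ≤ s` keeps the order at least two before each differentiation and at least
one at the end, so the remainder contributes nothing at the origin. -/
theorem multiDeriv {s : ℤ} {u v : EuclideanSpace ℝ (Fin d) → ℝ}
    (h : ApproxAtZero s u v) (α : Fin d → ℕ) (hs : (∑ i, α i : ℕ) + 1 ≤ s) :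
    ApproxAtZero (s - (∑ i, α i : ℕ)) (multiDeriv α u) (FlatLimit.multiDeriv α v) := by
  have e : ((List.finRange d).map α).sum = ∑ i, α i := by
    rw [← List.ofFn_eq_map, List.sum_ofFn]
  simpa only [FlatLimit.multiDeriv, e] using
    h.foldr_partialDeriv α (List.finRange d) (by rw [e]; exact hs)

end ApproxAtZero

/-! ### Higher partial derivatives of reflections, sums and monomials -/

theorem partialDeriv_const_mul_comp_sub_left (i : Fin d) (F : EuclideanSpace ℝ (Fin d) → ℝ)
    (c : ℝ) (x : EuclideanSpace ℝ (Fin d)) :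
    partialDeriv i (fun y => c * F (x - y)) = fun y => -c * partialDeriv i F (x - y) := by
  funext y
  simp only [partialDeriv, lineDeriv]
  rw [deriv_const_mul_field]
  have h := deriv_comp_neg (fun t : ℝ => F (x - y + t • EuclideanSpace.single i (1 : ℝ))) 0
  rw [neg_zero] at h
  rw [neg_mul, ← mul_neg, ← h]
  congr 2
  funext t
  congr 1
  module

/-- Each derivative in the second argument costs a sign. No regularity of `F` is needed, as `deriv`
commutes unconditionally with reflections and constant factors. -/
theorem multiDeriv_comp_sub_left (β : Fin d → ℕ) (F : EuclideanSpace ℝ (Fin d) → ℝ)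
    (x : EuclideanSpace ℝ (Fin d)) :
    multiDeriv β (fun y => F (x - y)) =
      fun y => (-1) ^ (∑ i, β i) * multiDeriv β F (x - y) := by
  have hit : ∀ (i : Fin d) (a : ℕ) (c : ℝ) (F : EuclideanSpace ℝ (Fin d) → ℝ),
      (partialDeriv i)^[a] (fun y => c * F (x - y)) =
        fun y => (c * (-1) ^ a) * (partialDeriv i)^[a] F (x - y) := by
    intro i a c F
    induction a with
    | zero => simp
    | succ a ih =>
      rw [Function.iterate_succ_apply', ih, partialDeriv_const_mul_comp_sub_left,
        Function.iterate_succ_apply']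
      funext y
      ring
  have hl : ∀ l : List (Fin d),
      l.foldr (fun i h => (partialDeriv i)^[β i] h) (fun y => F (x - y)) =
        fun y => (-1) ^ (l.map β).sum *
          l.foldr (fun i h => (partialDeriv i)^[β i] h) F (x - y) := by
    intro l
    induction l with
    | nil => simp
    | cons i l ih =>
      simp only [List.foldr_cons, List.map_cons, List.sum_cons]
      rw [ih, hit]
      funext y
      ring
  have e : ((List.finRange d).map β).sum = ∑ i, β i := by
    rw [← List.ofFn_eq_map, List.sum_ofFn]
  rw [← e]
  exact hl _

theorem partialDeriv_sum {ι : Type*} (s : Finset ι) (c : ι → ℝ)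
    (u : ι → EuclideanSpace ℝ (Fin d) → ℝ) (hu : ∀ μ, ContDiff ℝ (⊤ : ℕ∞) (u μ)) (i : Fin d) :
    partialDeriv i (fun y => ∑ μ ∈ s, c μ * u μ y) =
      fun y => ∑ μ ∈ s, c μ * partialDeriv i (u μ) y := by
  funext y
  have h : HasLineDerivAt ℝ (fun y => ∑ μ ∈ s, c μ * u μ y)
      (∑ μ ∈ s, c μ * partialDeriv i (u μ) y) y (EuclideanSpace.single i 1) :=
    HasDerivAt.fun_sum fun μ _ => HasDerivAt.const_mul (c μ)
      ((hu μ).differentiable (by simp) y).lineDifferentiableAt.hasLineDerivAt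
  exact h.lineDeriv

theorem multiDeriv_sum {ι : Type*} (s : Finset ι) (c : ι → ℝ)
    (u : ι → EuclideanSpace ℝ (Fin d) → ℝ) (hu : ∀ μ, ContDiff ℝ (⊤ : ℕ∞) (u μ))
    (β : Fin d → ℕ) :
    multiDeriv β (fun y => ∑ μ ∈ s, c μ * u μ y) =
      fun y => ∑ μ ∈ s, c μ * multiDeriv β (u μ) y := by
  have hit : ∀ (i : Fin d) (a : ℕ) (u : ι → EuclideanSpace ℝ (Fin d) → ℝ),
      (∀ μ, ContDiff ℝ (⊤ : ℕ∞) (u μ)) →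
      (∀ μ, ContDiff ℝ (⊤ : ℕ∞) ((partialDeriv i)^[a] (u μ))) ∧
      (partialDeriv i)^[a] (fun y => ∑ μ ∈ s, c μ * u μ y) =
        fun y => ∑ μ ∈ s, c μ * (partialDeriv i)^[a] (u μ) y := by
    intro i a u hu
    induction a with
    | zero => exact ⟨hu, rfl⟩
    | succ a ih =>
      simp only [Function.iterate_succ_apply']
      exact ⟨fun μ => contDiff_partialDeriv (ih.1 μ) i, by rw [ih.2, partialDeriv_sum _ _ _ ih.1]⟩
  have hl : ∀ l : List (Fin d),
      (∀ μ, ContDiff ℝ (⊤ : ℕ∞) (l.foldr (fun i h => (partialDeriv i)^[β i] h) (u μ))) ∧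
      l.foldr (fun i h => (partialDeriv i)^[β i] h) (fun y => ∑ μ ∈ s, c μ * u μ y) =
        fun y => ∑ μ ∈ s, c μ * l.foldr (fun i h => (partialDeriv i)^[β i] h) (u μ) y := by
    intro l
    induction l with
    | nil => exact ⟨hu, rfl⟩
    | cons i l ih =>
      simp only [List.foldr_cons]
      rw [ih.2]
      exact hit i (β i) _ ih.1
  exact (hl _).2

/-- Along the `i`-th basis vector only the `i`-th factor varies, so the other factors are constants
and the `φ j` may be arbitrary. -/
theorem partialDeriv_prod (i : Fin d) (φ : Fin d → ℝ → ℝ) :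
    partialDeriv i (fun y => ∏ j, φ j (y j)) =
      fun y => ∏ j, Function.update φ i (deriv (φ i)) j (y j) := by
  funext y
  simp only [partialDeriv, lineDeriv]
  have e : (fun t : ℝ => ∏ j, φ j ((y + t • EuclideanSpace.single i (1 : ℝ)) j)) =
      fun t => (∏ j ∈ Finset.univ.erase i, φ j (y j)) * φ i (y i + t) := by
    funext t
    rw [← Finset.prod_erase_mul _ _ (Finset.mem_univ i)]
    congr 1
    · refine Finset.prod_congr rfl fun j hj => ?_
      simp [Finset.ne_of_mem_erase hj]
    · simp
  rw [e, deriv_const_mul_field, deriv_comp_const_add, add_zero,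
    ← Finset.prod_erase_mul _ _ (Finset.mem_univ i), Function.update_self]
  congr 1
  refine Finset.prod_congr rfl fun j hj => ?_
  rw [Function.update_of_ne (Finset.ne_of_mem_erase hj)]

theorem multiDeriv_prod (β : Fin d → ℕ) (φ : Fin d → ℝ → ℝ) :
    multiDeriv β (fun y => ∏ j, φ j (y j)) = fun y => ∏ j, deriv^[β j] (φ j) (y j) := by
  have hit : ∀ (i : Fin d) (a : ℕ) (φ : Fin d → ℝ → ℝ),
      (partialDeriv i)^[a] (fun y => ∏ j, φ j (y j)) =
        fun y => ∏ j, Function.update φ i (deriv^[a] (φ i)) j (y j) := by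
    intro i a φ
    induction a with
    | zero => simp
    | succ a ih =>
      rw [Function.iterate_succ_apply', ih, partialDeriv_prod, Function.update_self,
        Function.update_idem, Function.iterate_succ_apply']
  -- Without repetitions in the list, each factor `φ j` is differentiated in one batch of `β j`
  -- derivatives.
  have hl : ∀ l : List (Fin d), l.Nodup →
      l.foldr (fun i h => (partialDeriv i)^[β i] h) (fun y => ∏ j, φ j (y j)) =
        fun y => ∏ j, (if j ∈ l then deriv^[β j] (φ j) else φ j) (y j) := by
    intro l hl
    induction l with
    | nil => simp
    | cons i l ih =>
      rw [List.nodup_cons] at hl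
      rw [List.foldr_cons, ih hl.2, hit i (β i) (fun j => if j ∈ l then deriv^[β j] (φ j) else φ j)]
      funext y
      refine Finset.prod_congr rfl fun j _ => ?_
      by_cases hj : j = i
      · subst hj
        simp [hl.1]
      · simp [hj]
  rw [multiDeriv, hl _ (List.nodup_finRange d)]
  simp

theorem multiDeriv_monomial_zero (β γ : Fin d → ℕ) :
    multiDeriv β (fun y : EuclideanSpace ℝ (Fin d) => ∏ j, y j ^ γ j) 0 =
      if γ = β then ∏ j, ((β j).factorial : ℝ) else 0 := by
  rw [multiDeriv_prod β (fun j t => t ^ γ j)]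
  have h1 : ∀ j, deriv^[β j] (fun t : ℝ => t ^ γ j) 0 =
      if γ j = β j then ((β j).factorial : ℝ) else 0 := by
    intro j
    rw [← iteratedDeriv_eq_iterate, iteratedDeriv_fun_pow_zero]
    by_cases h : γ j = β j
    · simp [h]
    · simp [h, Ne.symm h]
  simp only [PiLp.zero_apply, h1]
  split_ifs with h
  · simp [h]
  · obtain ⟨j, hj⟩ := Function.ne_iff.1 h
    exact Finset.prod_eq_zero (Finset.mem_univ j) (if_neg hj)

theorem contDiff_monomial (γ : Fin d → ℕ) :
    ContDiff ℝ (⊤ : ℕ∞) (fun y : EuclideanSpace ℝ (Fin d) => ∏ j, y j ^ γ j) := by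
  refine contDiff_prod fun j _ => ContDiff.pow ?_ _
  exact contDiff_euclidean.1 contDiff_id j

/-! ### Wronskians of polynomial kernels -/

/-- The kernel defined by a polynomial in two groups of variables. -/
noncomputable def polyKernel (Q : MvPolynomial (Fin d ⊕ Fin d) ℝ)
    (x y : EuclideanSpace ℝ (Fin d)) : ℝ :=
  MvPolynomial.eval (Sum.elim x y) Q

/-- The coefficient of `x^α y^β` in a polynomial in two groups of variables. -/
noncomputable def biCoeff (Q : MvPolynomial (Fin d ⊕ Fin d) ℝ) (α β : Fin d → ℕ) : ℝ :=
  Q.coeff (Finsupp.equivFunOnFinite.symm (Sum.elim α β))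

theorem polyKernel_eq_sum (Q : MvPolynomial (Fin d ⊕ Fin d) ℝ) (x y : EuclideanSpace ℝ (Fin d)) :
    polyKernel Q x y = ∑ μ ∈ Q.support,
      Q.coeff μ * ((∏ j, x j ^ μ (Sum.inl j)) * ∏ j, y j ^ μ (Sum.inr j)) := by
  simp [polyKernel, MvPolynomial.eval_eq', Fintype.prod_sum_type]

/-- At the origin the derivative of order `(α, β)` annihilates every monomial except `x^α y^β`, on
which it gives `α! β!`, the normalisation in the Wronskian. -/
theorem wronskian_polyKernel (Q : MvPolynomial (Fin d ⊕ Fin d) ℝ) (α β : Fin d → ℕ) :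
    wronskian (polyKernel Q) α β = biCoeff Q α β := by
  have hy : (fun x => multiDeriv β (fun y => polyKernel Q x y) 0) = fun x =>
      ∑ μ ∈ Q.support, (Q.coeff μ * multiDeriv β
        (fun y : EuclideanSpace ℝ (Fin d) => ∏ j, y j ^ μ (Sum.inr j)) 0) *
          ∏ j, x j ^ μ (Sum.inl j) := by
    funext x
    simp only [polyKernel_eq_sum, ← mul_assoc]
    rw [multiDeriv_sum Q.support (fun μ => Q.coeff μ * ∏ j, x j ^ μ (Sum.inl j))
      (fun μ y => ∏ j, y j ^ μ (Sum.inr j)) fun μ => contDiff_monomial _]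
    exact Finset.sum_congr rfl fun μ _ => by ring
  have hf : ∀ γ : Fin d → ℕ, (∏ i, ((γ i).factorial : ℝ)) ≠ 0 := fun γ =>
    Finset.prod_ne_zero_iff.2 fun i _ => by positivity
  simp only [wronskian, Matrix.of_apply]
  rw [hy, multiDeriv_sum Q.support _ (fun μ x => ∏ j, x j ^ μ (Sum.inl j))
    fun μ => contDiff_monomial _, div_eq_iff (mul_ne_zero (hf α) (hf β))]
  simp only [multiDeriv_monomial_zero, biCoeff]
  rw [Finset.sum_eq_single (Finsupp.equivFunOnFinite.symm (Sum.elim α β))]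
  · simp
    ring
  · intro μ _ hμ
    by_cases h1 : (fun j => μ (Sum.inl j)) = α
    · by_cases h2 : (fun j => μ (Sum.inr j)) = β
      · refine absurd ?_ hμ
        ext (j | j)
        · simp [← h1]
        · simp [← h2]
      · simp [h2]
    · simp [h1]
  · intro h
    simp [MvPolynomial.notMem_support_iff.1 h]

/-! ### The polynomial part of a stationary kernel -/

theorem taylorCoeff_odd_eq_zero {f : ℝ → ℝ} {k : ℕ} (hk : (k : ℕ∞) < smoothnessOrder f) {j : ℕ}
    (hj : j < k) : taylorCoeff f (2 * j + 1) = 0 := by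
  by_contra h
  have h1 : smoothnessOrder f ≤ ((j + 1 : ℕ) : ℕ∞) :=
    sInf_le ⟨j + 1, by lia, by simpa [show 2 * (j + 1) - 1 = 2 * j + 1 by lia] using h, rfl⟩
  have h2 := hk.trans_le h1
  rw [Nat.cast_lt] at h2
  lia

theorem exists_eq_even_part_add {f : ℝ → ℝ} (hf : AnalyticAt ℝ f 0) {k : ℕ}
    (hk : (k : ℕ∞) < smoothnessOrder f) :
    ∃ F : ℝ → ℝ, AnalyticAt ℝ F 0 ∧ ∀ t, f t =
      ∑ i ∈ Finset.range (k + 1), taylorCoeff f (2 * i) * (t ^ 2) ^ i + t ^ (2 * k + 1) * F t := by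
  obtain ⟨F, hF, h⟩ := hf.exists_eq_sum_add_pow_mul (2 * k + 1)
  refine ⟨F, hF, fun t => ?_⟩
  rw [h t, smul_eq_mul]
  congr 1
  -- The induction adds two Taylor terms at a time: the odd one vanishes because `2j + 1 = 2(j + 1)
  -- - 1` with `j + 1 ≤ k`.
  have : ∀ j ≤ k, ∑ i ∈ Finset.range (2 * j + 1),
      (t ^ i / (i.factorial : ℝ)) • iteratedDeriv i f 0 =
      ∑ i ∈ Finset.range (j + 1), taylorCoeff f (2 * i) * (t ^ 2) ^ i := by
    intro j hj
    induction j with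
    | zero => simp [taylorCoeff]
    | succ j ih =>
      have h0 := taylorCoeff_odd_eq_zero hk (show j < k by lia)
      rw [show 2 * (j + 1) + 1 = 2 * j + 1 + 1 + 1 by ring, Finset.sum_range_succ,
        Finset.sum_range_succ, ih (by lia), Finset.sum_range_succ _ (j + 1)]
      have h1 : iteratedDeriv (2 * j + 1) f 0 = 0 := by
        rw [taylorCoeff, div_eq_zero_iff] at h0
        exact h0.resolve_right (by positivity)
      rw [h1, smul_zero, add_zero]
      congr 1
      simp only [taylorCoeff, smul_eq_mul, ← pow_mul]
      rw [show 2 * (j + 1) = 2 * j + 1 + 1 by ring]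
      ring
  exact this k le_rfl

/-- The polynomial `∑_{i ≤ k} f_{2i} ‖x - y‖^{2i}`. -/
noncomputable def evenPoly (d : ℕ) (f : ℝ → ℝ) (k : ℕ) : MvPolynomial (Fin d ⊕ Fin d) ℝ :=
  ∑ i ∈ Finset.range (k + 1), MvPolynomial.C (taylorCoeff f (2 * i)) *
    (∑ j : Fin d, (MvPolynomial.X (Sum.inl j) - MvPolynomial.X (Sum.inr j)) ^ 2) ^ i

theorem polyKernel_evenPoly (f : ℝ → ℝ) (k : ℕ) (x y : EuclideanSpace ℝ (Fin d)) :
    polyKernel (evenPoly d f k) x y =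
      ∑ i ∈ Finset.range (k + 1), taylorCoeff f (2 * i) * (‖x - y‖ ^ 2) ^ i := by
  simp [polyKernel, evenPoly, EuclideanSpace.real_norm_sq_eq]

theorem totalDegree_evenPoly_le (f : ℝ → ℝ) (k : ℕ) : (evenPoly d f k).totalDegree ≤ 2 * k := by
  refine MvPolynomial.totalDegree_finsetSum_le fun i hi => ?_
  refine (MvPolynomial.totalDegree_mul _ _).trans ?_
  rw [MvPolynomial.totalDegree_C, zero_add]
  refine (MvPolynomial.totalDegree_pow _ _).trans ?_
  have : (∑ j : Fin d, ((MvPolynomial.X (Sum.inl j) - MvPolynomial.X (Sum.inr j) :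
      MvPolynomial (Fin d ⊕ Fin d) ℝ)) ^ 2).totalDegree ≤ 2 := by
    refine MvPolynomial.totalDegree_finsetSum_le fun j _ => ?_
    refine (MvPolynomial.totalDegree_pow _ _).trans ?_
    have := MvPolynomial.totalDegree_sub (MvPolynomial.X (Sum.inl j) :
      MvPolynomial (Fin d ⊕ Fin d) ℝ) (MvPolynomial.X (Sum.inr j))
    simp only [MvPolynomial.totalDegree_X, max_self] at this
    lia
  rw [Finset.mem_range] at hi
  nlinarith

theorem biCoeff_eq_zero {Q : MvPolynomial (Fin d ⊕ Fin d) ℝ} {N : ℕ} (hQ : Q.totalDegree ≤ N)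
    {α β : Fin d → ℕ} (h : N < ∑ i, α i + ∑ i, β i) : biCoeff Q α β = 0 := by
  by_contra h0
  have := MvPolynomial.le_totalDegree (MvPolynomial.mem_support_iff.2 h0)
  rw [Finsupp.sum_fintype _ _ fun _ => rfl, Fintype.sum_sum_type] at this
  simp at this
  lia

/-- The kernel need not be smooth on the diagonal, but it differs from its polynomial part by a
remainder of order `2k + 1 > |α| + |β|`, which these derivatives do not see at the origin. Both are
functions of `x - y`, so derivatives in `y` become signed derivatives of the profile. -/
theorem wronskian_eq_biCoeff {κ : EuclideanSpace ℝ (Fin d) → EuclideanSpace ℝ (Fin d) → ℝ}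
    {f : ℝ → ℝ} (hκ : IsStationaryKernel κ f) {k : ℕ} (hk : (k : ℕ∞) < smoothnessOrder f)
    {α β : Fin d → ℕ} (h : ∑ i, α i + ∑ i, β i ≤ 2 * k) :
    wronskian κ α β = biCoeff (evenPoly d f k) α β := by
  obtain ⟨F, hF, hf⟩ := exists_eq_even_part_add hκ.analytic hk
  rw [← wronskian_polyKernel]
  have h1 : ApproxAtZero (2 * k + 1 : ℤ) (fun z : EuclideanSpace ℝ (Fin d) => f ‖z‖)
      (fun z => ∑ i ∈ Finset.range (k + 1), taylorCoeff f (2 * i) * (‖z‖ ^ 2) ^ i) := by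
    refine ⟨ContDiff.sum fun i _ => contDiff_const.mul ((contDiff_norm_sq ℝ).pow i), _,
      IsRadialRemainder.radial _ F hF, Eventually.of_forall fun z => ?_⟩
    dsimp only
    rw [hf ‖z‖]
    norm_cast
  have h2 := (h1.multiDeriv β (by lia)).const_mul ((-1) ^ (∑ i, β i))
  have h3 := (h2.multiDeriv α (by lia)).apply_zero (by lia)
  have e : ∀ G : EuclideanSpace ℝ (Fin d) → ℝ,
      (fun x => multiDeriv β (fun y => G (x - y)) 0) =
        fun x => (-1) ^ (∑ i, β i) * multiDeriv β G x := by
    intro G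
    funext x
    simp only [multiDeriv_comp_sub_left, sub_zero]
  rw [← e, ← e] at h3
  simp only [wronskian, Matrix.of_apply, hκ.eq_radial, polyKernel_evenPoly]
  rw [h3]

/-! ### Expansion of the kernel matrix -/

/-- The multi-indices of degree at most `N`. -/
noncomputable def multiLE (d N : ℕ) : Finset (Fin d → ℕ) := (finite_multi d N).toFinset

theorem mem_multiLE {N : ℕ} {α : Fin d → ℕ} : α ∈ multiLE d N ↔ ∑ i, α i ≤ N := by
  simp [multiLE]

theorem polyKernel_eq_sum_biCoeff {Q : MvPolynomial (Fin d ⊕ Fin d) ℝ} {N : ℕ}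
    (hQ : Q.totalDegree ≤ N) (x y : EuclideanSpace ℝ (Fin d)) :
    polyKernel Q x y = ∑ α ∈ multiLE d N, ∑ β ∈ multiLE d N,
      (∏ j, x j ^ α j) * biCoeff Q α β * ∏ j, y j ^ β j := by
  let e : (Fin d ⊕ Fin d →₀ ℕ) ≃ (Fin d → ℕ) × (Fin d → ℕ) :=
    Finsupp.equivFunOnFinite.trans (Equiv.sumArrowEquivProdArrow _ _ _)
  have he : ∀ p, Q.coeff (e.symm p) = biCoeff Q p.1 p.2 := fun p => rfl
  rw [polyKernel_eq_sum, ← Finset.sum_product']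
  rw [← Finset.sum_subset (s₁ := Q.support.map e.toEmbedding)]
  · rw [Finset.sum_map]
    refine Finset.sum_congr rfl fun μ _ => ?_
    have h := he (e μ)
    rw [Equiv.symm_apply_apply] at h
    simp only [Equiv.coe_toEmbedding, ← h]
    simp only [e, Equiv.trans_apply, Equiv.sumArrowEquivProdArrow, Equiv.coe_fn_mk,
      Finsupp.equivFunOnFinite_apply, Function.comp_apply]
    ring
  · intro p hp
    obtain ⟨μ, hμ, rfl⟩ := Finset.mem_map.1 hp
    have := MvPolynomial.le_totalDegree hμ
    rw [Finsupp.sum_fintype _ _ fun _ => rfl, Fintype.sum_sum_type] at this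
    simp only [Finset.mem_product, mem_multiLE]
    simp only [e, Equiv.coe_toEmbedding, Equiv.trans_apply, Equiv.sumArrowEquivProdArrow,
      Equiv.coe_fn_mk, Finsupp.equivFunOnFinite_apply, Function.comp_apply]
    lia
  · intro p _ hp
    have : e.symm p ∉ Q.support := fun h => hp (Finset.mem_map.2 ⟨_, h, by simp⟩)
    rw [← he, MvPolynomial.notMem_support_iff.1 this, mul_zero, zero_mul]

/-- The multi-indices of degree at most `N` and larger than `k`. -/
noncomputable def multiHigh (d k N : ℕ) : Finset (Fin d → ℕ) := by
  classical exact (multiLE d N).filter fun α => k < ∑ i, α i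

theorem mem_multiHigh {k N : ℕ} {α : Fin d → ℕ} :
    α ∈ multiHigh d k N ↔ ∑ i, α i ≤ N ∧ k < ∑ i, α i := by
  classical simp [multiHigh, mem_multiLE]

theorem sum_multiLE {k N : ℕ} (hk : k ≤ N) (h : (Fin d → ℕ) → ℝ) :
    ∑ α ∈ multiLE d N, h α =
      ∑ α : MultiLT d k, h α + ∑ α : MultiEq d k, h α + ∑ α ∈ multiHigh d k N, h α := by
  classical
  rw [← Finset.sum_subtype ((multiLE d N).filter fun α => ∑ i, α i < k)
      (by intro α; simp [mem_multiLE]; lia) h,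
    ← Finset.sum_subtype ((multiLE d N).filter fun α => ∑ i, α i = k)
      (by intro α; simp [mem_multiLE]; lia) h,
    ← Finset.sum_union (by
      rw [Finset.disjoint_filter]; intro α _; lia),
    ← Finset.sum_union (by
      rw [Finset.disjoint_left]; intro α; simp [mem_multiHigh, mem_multiLE]; lia)]
  refine Finset.sum_congr ?_ fun _ _ => rfl
  ext α
  simp [mem_multiHigh, mem_multiLE]
  lia

/-- The diagonal matrix of the powers `ε^|α|`, `|α| < k`. -/
noncomputable def scaling (d k : ℕ) (ε : ℝ) : Matrix (MultiLT d k) (MultiLT d k) ℝ :=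
  Matrix.diagonal fun α => ε ^ (∑ i, α.1 i)

theorem mul_mul_transpose_apply {l m n p : Type*} [Fintype m] [Fintype n]
    (A : Matrix l m ℝ) (B : Matrix m n ℝ) (C : Matrix p n ℝ) (i : l) (j : p) :
    (A * B * C.transpose) i j = ∑ a, ∑ b, A i a * B a b * C j b := by
  simp only [Matrix.mul_apply, Matrix.transpose_apply, Finset.sum_mul]
  exact Finset.sum_comm

/-- Each exponent of `Q` is of degree below `k`, equal to `k`, or above `k`. Total degree at most
`2k` excludes the pairs (equal, above), (above, equal) and (above, above). The pairs (below, above)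
and (above, below) give `C` and `C'`, and the non-polynomial tail gives `R`. -/
theorem exists_kernelMatrix_expansion
    {κ : EuclideanSpace ℝ (Fin d) → EuclideanSpace ℝ (Fin d) → ℝ}
    {f : ℝ → ℝ} (hκ : IsStationaryKernel κ f) {k : ℕ} (hk : (k : ℕ∞) < smoothnessOrder f)
    {n : ℕ} (x : Fin n → EuclideanSpace ℝ (Fin d)) :
    ∃ (C : ℝ → Matrix (MultiLT d k) (Fin n) ℝ) (C' : ℝ → Matrix (Fin n) (MultiLT d k) ℝ)
      (R : ℝ → Matrix (Fin n) (Fin n) ℝ),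
      ContinuousAt C 0 ∧ ContinuousAt C' 0 ∧ ContinuousAt R 0 ∧ ∀ ε > 0,
        kernelMatrix κ x ε =
          (vandermondeLT x k * scaling d k ε) * wronskianLT κ k *
              (vandermondeLT x k * scaling d k ε).transpose +
            ε ^ k • ((vandermondeLT x k * scaling d k ε) *
              (wronskianTopRight κ k * (vandermondeEq x k).transpose + ε • C ε)) +
            ε ^ k • ((vandermondeEq x k * wronskianBottomLeft κ k + ε • C' ε) *
              (vandermondeLT x k * scaling d k ε).transpose) +
            ε ^ (2 * k) • (vandermondeEq x k * wronskianBottomRight κ k *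
              (vandermondeEq x k).transpose + ε • R ε) := by
  obtain ⟨F, hF, hf⟩ := exists_eq_even_part_add hκ.analytic hk
  set Q := evenPoly d f k with hQ
  have hdeg : Q.totalDegree ≤ 2 * k := totalDegree_evenPoly_le f k
  -- Degrees in `multiHigh` exceed `k`, so the truncated subtraction `|β| - k - 1` is exact: `ε^k`
  -- and one more factor `ε` have been taken out.
  refine ⟨fun ε => Matrix.of fun α j => ∑ β ∈ multiHigh d k (2 * k),
      ε ^ (∑ i, β i - k - 1) * (biCoeff Q α.1 β * ∏ i, x j i ^ β i),
    fun ε => Matrix.of fun j β => ∑ α ∈ multiHigh d k (2 * k),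
      ε ^ (∑ i, α i - k - 1) * ((∏ i, x j i ^ α i) * biCoeff Q α β.1),
    fun ε => Matrix.of fun i j => ‖x i - x j‖ ^ (2 * k + 1) * F (ε * ‖x i - x j‖), ?_, ?_, ?_, ?_⟩
  · refine continuousAt_pi.2 fun α => continuousAt_pi.2 fun j => ?_
    simp only [Matrix.of_apply]
    fun_prop
  · refine continuousAt_pi.2 fun α => continuousAt_pi.2 fun j => ?_
    simp only [Matrix.of_apply]
    fun_prop
  · refine continuousAt_pi.2 fun i => continuousAt_pi.2 fun j => ?_
    simp only [Matrix.of_apply]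
    refine continuousAt_const.mul (ContinuousAt.comp (g := F) ?_ (by fun_prop))
    simpa using hF.continuousAt
  · intro ε hε
    ext i j
    have hK : kernelMatrix κ x ε i j = polyKernel Q (ε • x i) (ε • x j) +
        ε ^ (2 * k) * (ε * (‖x i - x j‖ ^ (2 * k + 1) * F (ε * ‖x i - x j‖))) := by
      simp only [kernelMatrix, Matrix.of_apply, hκ.eq_radial, hQ, polyKernel_evenPoly]
      rw [hf, ← smul_sub, norm_smul, Real.norm_of_nonneg hε.le]
      ring
    have hmon : ∀ (i : Fin n) (α : Fin d → ℕ),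
        (∏ j, (ε • x i) j ^ α j) = ε ^ (∑ j, α j) * ∏ j, x i j ^ α j := by
      intro i α
      simp [mul_pow, Finset.prod_mul_distrib, Finset.prod_pow_eq_pow_sum]
    have hEH : ∀ α : MultiEq d k, ∀ β ∈ multiHigh d k (2 * k), biCoeff Q α.1 β = 0 :=
      fun α β hβ => biCoeff_eq_zero hdeg (by rw [α.2]; have := (mem_multiHigh.1 hβ).2; lia)
    have hHE : ∀ β : MultiEq d k, ∀ α ∈ multiHigh d k (2 * k), biCoeff Q α β.1 = 0 :=
      fun β α hα => biCoeff_eq_zero hdeg (by rw [β.2]; have := (mem_multiHigh.1 hα).2; lia)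
    have hHH : ∀ α ∈ multiHigh d k (2 * k), ∀ β ∈ multiHigh d k (2 * k), biCoeff Q α β = 0 :=
      fun α hα β hβ => biCoeff_eq_zero hdeg (by
        have := (mem_multiHigh.1 hα).2; have := (mem_multiHigh.1 hβ).2; lia)
    have hA : ∀ i α, (vandermondeLT x k * scaling d k ε) i α =
        ε ^ (∑ j, α.1 j) * ∏ j, x i j ^ α.1 j := by
      intro i α
      rw [scaling, Matrix.mul_diagonal, mul_comm]
      rfl
    have hB : ∀ i α, vandermondeEq x k i α = ∏ j, x i j ^ α.1 j := fun i α => rfl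
    have h11 : ∀ α β, wronskianLT κ k α β = biCoeff Q α.1 β.1 := fun α β =>
      wronskian_eq_biCoeff hκ hk (by have := α.2; have := β.2; lia)
    have h12 : ∀ α β, wronskianTopRight κ k α β = biCoeff Q α.1 β.1 := fun α β =>
      wronskian_eq_biCoeff hκ hk (by have := α.2; have := β.2; lia)
    have h21 : ∀ α β, wronskianBottomLeft κ k α β = biCoeff Q α.1 β.1 := fun α β =>
      wronskian_eq_biCoeff hκ hk (by have := α.2; have := β.2; lia)
    have h22 : ∀ α β, wronskianBottomRight κ k α β = biCoeff Q α.1 β.1 := fun α β =>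
      wronskian_eq_biCoeff hκ hk (by have := α.2; have := β.2; lia)
    rw [hK, polyKernel_eq_sum_biCoeff hdeg]
    simp only [hmon, sum_multiLE (show k ≤ 2 * k by lia)]
    simp only [Finset.sum_add_distrib]
    rw [Matrix.mul_add, Matrix.add_mul, ← Matrix.mul_assoc]
    simp only [Matrix.add_apply, Matrix.smul_apply, smul_eq_mul, mul_mul_transpose_apply, hA, hB,
      h11, h12, h21, h22]
    have e1 : ∑ α : MultiEq d k, ∑ β ∈ multiHigh d k (2 * k),
        (ε ^ (∑ j, α.1 j) * ∏ j, x i j ^ α.1 j) * biCoeff Q α.1 β *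
          (ε ^ (∑ j, β j) * ∏ i, x j i ^ β i) = 0 :=
      Finset.sum_eq_zero fun α _ => Finset.sum_eq_zero fun β hβ => by simp [hEH α β hβ]
    have e2 : ∑ α ∈ multiHigh d k (2 * k), ∑ β : MultiEq d k,
        (ε ^ (∑ j, α j) * ∏ j, x i j ^ α j) * biCoeff Q α β.1 *
          (ε ^ (∑ j, β.1 j) * ∏ i, x j i ^ β.1 i) = 0 :=
      Finset.sum_eq_zero fun α hα => Finset.sum_eq_zero fun β _ => by simp [hHE β α hα]
    have e3 : ∑ α ∈ multiHigh d k (2 * k), ∑ β ∈ multiHigh d k (2 * k),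
        (ε ^ (∑ j, α j) * ∏ j, x i j ^ α j) * biCoeff Q α β *
          (ε ^ (∑ j, β j) * ∏ i, x j i ^ β i) = 0 :=
      Finset.sum_eq_zero fun α hα => Finset.sum_eq_zero fun β hβ => by simp [hHH α hα β hβ]
    rw [e1, e2, e3]
    have hp : ∀ β ∈ multiHigh d k (2 * k),
        ε ^ (∑ i, β i) = ε ^ k * (ε * ε ^ (∑ i, β i - k - 1)) := by
      intro β hβ
      have := (mem_multiHigh.1 hβ).2
      rw [← pow_succ', ← pow_add]
      congr 1
      lia
    have e4 : ∑ α : MultiLT d k, ∑ β : MultiEq d k,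
        (ε ^ (∑ j, α.1 j) * ∏ j, x i j ^ α.1 j) * biCoeff Q α.1 β.1 *
          (ε ^ (∑ j, β.1 j) * ∏ i, x j i ^ β.1 i) =
        ε ^ k * ∑ α : MultiLT d k, ∑ β : MultiEq d k,
          (ε ^ (∑ j, α.1 j) * ∏ j, x i j ^ α.1 j) * biCoeff Q α.1 β.1 *
            (∏ i, x j i ^ β.1 i) := by
      simp only [Finset.mul_sum]
      refine Finset.sum_congr rfl fun α _ => Finset.sum_congr rfl fun β _ => ?_
      rw [β.2]
      ring
    have e5 : ∑ α : MultiEq d k, ∑ β : MultiLT d k,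
        (ε ^ (∑ j, α.1 j) * ∏ j, x i j ^ α.1 j) * biCoeff Q α.1 β.1 *
          (ε ^ (∑ j, β.1 j) * ∏ i, x j i ^ β.1 i) =
        ε ^ k * ∑ α : MultiEq d k, ∑ β : MultiLT d k,
          (∏ j, x i j ^ α.1 j) * biCoeff Q α.1 β.1 *
            (ε ^ (∑ j, β.1 j) * ∏ i, x j i ^ β.1 i) := by
      simp only [Finset.mul_sum]
      refine Finset.sum_congr rfl fun α _ => Finset.sum_congr rfl fun β _ => ?_
      rw [α.2]
      ring
    have e6 : ∑ α : MultiEq d k, ∑ β : MultiEq d k,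
        (ε ^ (∑ j, α.1 j) * ∏ j, x i j ^ α.1 j) * biCoeff Q α.1 β.1 *
          (ε ^ (∑ j, β.1 j) * ∏ i, x j i ^ β.1 i) =
        ε ^ (2 * k) * ∑ α : MultiEq d k, ∑ β : MultiEq d k,
          (∏ j, x i j ^ α.1 j) * biCoeff Q α.1 β.1 * (∏ i, x j i ^ β.1 i) := by
      simp only [Finset.mul_sum]
      refine Finset.sum_congr rfl fun α _ => Finset.sum_congr rfl fun β _ => ?_
      rw [α.2, β.2]
      ring
    have e7 : ∑ α : MultiLT d k, ∑ β ∈ multiHigh d k (2 * k),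
        (ε ^ (∑ j, α.1 j) * ∏ j, x i j ^ α.1 j) * biCoeff Q α.1 β *
          (ε ^ (∑ j, β j) * ∏ i, x j i ^ β i) =
        ε ^ k * ((vandermondeLT x k * scaling d k ε) * (ε • Matrix.of fun (α : MultiLT d k) j =>
          ∑ β ∈ multiHigh d k (2 * k),
            ε ^ (∑ i, β i - k - 1) * (biCoeff Q α.1 β * ∏ i, x j i ^ β i))) i j := by
      rw [Matrix.mul_apply]
      simp only [hA, Matrix.smul_apply, Matrix.of_apply, smul_eq_mul, Finset.mul_sum]
      refine Finset.sum_congr rfl fun α _ => Finset.sum_congr rfl fun β hβ => ?_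
      rw [hp β hβ]
      ring
    have e8 : ∑ α ∈ multiHigh d k (2 * k), ∑ β : MultiLT d k,
        (ε ^ (∑ j, α j) * ∏ j, x i j ^ α j) * biCoeff Q α β.1 *
          (ε ^ (∑ j, β.1 j) * ∏ i, x j i ^ β.1 i) =
        ε ^ k * ((ε • Matrix.of fun j (β : MultiLT d k) => ∑ α ∈ multiHigh d k (2 * k),
            ε ^ (∑ i, α i - k - 1) * ((∏ i, x j i ^ α i) * biCoeff Q α β.1)) *
          (vandermondeLT x k * scaling d k ε).transpose) i j := by
      rw [Matrix.mul_apply, Finset.sum_comm]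
      simp only [hA, Matrix.transpose_apply, Matrix.smul_apply, Matrix.of_apply, smul_eq_mul,
        Finset.mul_sum, Finset.sum_mul]
      refine Finset.sum_congr rfl fun α _ => Finset.sum_congr rfl fun β hβ => ?_
      rw [hp β hβ]
      ring
    rw [e4, e5, e6, e7, e8]
    simp only [Matrix.of_apply]
    ring

/-! ### Block matrices -/

theorem continuousAt_matrix_mul {X l m n : Type*} [TopologicalSpace X] [Fintype m]
    {A : X → Matrix l m ℝ} {B : X → Matrix m n ℝ} {a : X} (hA : ContinuousAt A a)
    (hB : ContinuousAt B a) : ContinuousAt (fun t => A t * B t) a :=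
  ContinuousAt.comp (g := fun p : Matrix l m ℝ × Matrix m n ℝ => p.1 * p.2)
    (continuous_fst.matrix_mul continuous_snd).continuousAt (hA.prodMk hB)

theorem continuousAt_fromBlocks {X l m n o : Type*} [TopologicalSpace X]
    {A : X → Matrix n l ℝ} {B : X → Matrix n m ℝ} {C : X → Matrix o l ℝ} {D : X → Matrix o m ℝ}
    {a : X} (hA : ContinuousAt A a) (hB : ContinuousAt B a) (hC : ContinuousAt C a)
    (hD : ContinuousAt D a) :
    ContinuousAt (fun t => Matrix.fromBlocks (A t) (B t) (C t) (D t)) a := by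
  refine ContinuousAt.comp (g := fun p : (Matrix n l ℝ × Matrix n m ℝ) ×
    (Matrix o l ℝ × Matrix o m ℝ) => Matrix.fromBlocks p.1.1 p.1.2 p.2.1 p.2.2)
    ?_ ((hA.prodMk hB).prodMk (hC.prodMk hD))
  exact (Continuous.matrix_fromBlocks (by fun_prop) (by fun_prop) (by fun_prop)
    (by fun_prop)).continuousAt

theorem continuousAt_matrix_det {X n : Type*} [TopologicalSpace X] [Fintype n] [DecidableEq n]
    {A : X → Matrix n n ℝ} {a : X} (hA : ContinuousAt A a) :
    ContinuousAt (fun t => (A t).det) a :=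
  ContinuousAt.comp (g := fun M : Matrix n n ℝ => M.det) (by fun_prop) hA

/-- Completing the square and a Schur complement identity: the determinant of a perturbation of a
scaled matrix of low rank as a bordered determinant. -/
theorem det_scaled_perturbation {ι P : Type*} [Fintype ι] [DecidableEq ι] [Fintype P]
    [DecidableEq P] (A : Matrix ι P ℝ) (W D E : Matrix P P ℝ) (U : Matrix P ι ℝ)
    (U' : Matrix ι P ℝ) (S : Matrix ι ι ℝ) {c : ℝ} (hc : c ≠ 0) (hW : IsUnit W.det)
    (hDE : D * E = c • 1) (hED : E * D = c • 1) (hD : D.transpose = D) :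
    ((A * D) * W * (A * D).transpose + c • ((A * D) * U) + c • (U' * (A * D).transpose) +
        c ^ 2 • S).det * E.det ^ 2 =
      (c ^ 2) ^ Fintype.card ι * ((-1) ^ Fintype.card P * W.det *
        (Matrix.fromBlocks (S - U' * W⁻¹ * U) (A + U' * W⁻¹ * E) (A.transpose + E * W⁻¹ * U)
          (-(E * W⁻¹ * E))).det) := by
  have hWW : W * W⁻¹ = 1 := Matrix.mul_nonsing_inv W hW
  have hWW' : W⁻¹ * W = 1 := Matrix.nonsing_inv_mul W hW
  -- As `D E = E D = c`, the block `-E W⁻¹ E` has the explicit inverse `-c⁻² D W D`, which makes its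
  -- Schur complement computable.
  have hinv : (-(E * W⁻¹ * E)) * (-((c ^ 2)⁻¹ • (D * W * D))) = 1 := by
    rw [neg_mul_neg, Matrix.mul_smul]
    calc (c ^ 2)⁻¹ • (E * W⁻¹ * E * (D * W * D))
        = (c ^ 2)⁻¹ • (E * (W⁻¹ * ((E * D) * (W * D)))) := by simp only [Matrix.mul_assoc]
      _ = (c ^ 2)⁻¹ • (c • (E * ((W⁻¹ * W) * D))) := by
          rw [hED]; simp [Matrix.mul_assoc]
      _ = 1 := by
          rw [hWW', Matrix.one_mul, hED, smul_smul, smul_smul]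
          rw [show (c ^ 2)⁻¹ * c * c = 1 by field_simp, one_smul]
  let : Invertible (-(E * W⁻¹ * E)) :=
    ⟨-((c ^ 2)⁻¹ • (D * W * D)), mul_eq_one_comm.1 hinv, hinv⟩
  have hI : ⅟(-(E * W⁻¹ * E)) = -((c ^ 2)⁻¹ • (D * W * D)) := rfl
  rw [Matrix.det_fromBlocks₂₂, hI]
  have h1 : (A + U' * W⁻¹ * E) * D = A * D + c • (U' * W⁻¹) := by
    rw [Matrix.add_mul, Matrix.mul_assoc _ E D, hED, Matrix.mul_smul, Matrix.mul_one]
  have h2 : D * (A.transpose + E * W⁻¹ * U) = (A * D).transpose + c • (W⁻¹ * U) := by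
    rw [Matrix.mul_add, Matrix.mul_assoc E, ← Matrix.mul_assoc D E, hDE, Matrix.smul_mul,
      Matrix.one_mul, Matrix.transpose_mul, hD]
  -- Completing the square: `(A D + c U' W⁻¹) W ((A D)ᵀ + c W⁻¹ U)` produces both cross terms, and
  -- its surplus `c² U' W⁻¹ U` is removed by the correction to `S`.
  have h3 : (A * D) * W * (A * D).transpose + c • ((A * D) * U) + c • (U' * (A * D).transpose) +
        c ^ 2 • S = c ^ 2 • (S - U' * W⁻¹ * U - (A + U' * W⁻¹ * E) *
          (-((c ^ 2)⁻¹ • (D * W * D))) * (A.transpose + E * W⁻¹ * U)) := by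
    have h4 : (A + U' * W⁻¹ * E) * (-((c ^ 2)⁻¹ • (D * W * D))) * (A.transpose + E * W⁻¹ * U) =
        -((c ^ 2)⁻¹ • (((A + U' * W⁻¹ * E) * D) * W * (D * (A.transpose + E * W⁻¹ * U)))) := by
      simp only [Matrix.mul_neg, Matrix.neg_mul, Matrix.mul_smul, Matrix.smul_mul,
        Matrix.mul_assoc]
    rw [h4, h1, h2, sub_neg_eq_add, smul_add, smul_smul, mul_inv_cancel₀ (pow_ne_zero 2 hc),
      one_smul]
    have h5 : (A * D + c • (U' * W⁻¹)) * W = A * D * W + c • U' := by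
      rw [Matrix.add_mul, Matrix.smul_mul, Matrix.mul_assoc U', hWW', Matrix.mul_one]
    rw [h5, Matrix.add_mul, Matrix.mul_add, Matrix.mul_add, Matrix.mul_smul, Matrix.mul_smul,
      Matrix.smul_mul, Matrix.smul_mul, Matrix.mul_assoc (A * D) W (W⁻¹ * U),
      ← Matrix.mul_assoc W, hWW, Matrix.one_mul, ← Matrix.mul_assoc U']
    module
  rw [h3, Matrix.det_smul, Matrix.det_neg, Matrix.det_mul, Matrix.det_mul]
  have h6 : W⁻¹.det * W.det = 1 := by rw [← Matrix.det_mul, hWW', Matrix.det_one]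
  have h7 : ((-1 : ℝ) ^ Fintype.card P) * (-1) ^ Fintype.card P = 1 := by
    rw [← mul_pow]; simp
  generalize (S - U' * W⁻¹ * U - _).det = δ
  linear_combination ((c ^ 2) ^ Fintype.card ι * δ * E.det ^ 2) * (-h6 * ((-1) ^ Fintype.card P *
    (-1) ^ Fintype.card P) - h7)

/-- A limit of positive semi-definite matrices is positive semi-definite. -/
theorem posSemidef_of_tendsto {X n : Type*} [Fintype n] {l : Filter X} [l.NeBot]
    {A : X → Matrix n n ℝ} {B : Matrix n n ℝ} (h : Tendsto A l (𝓝 B))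
    (hA : ∀ᶠ t in l, (A t).PosSemidef) : B.PosSemidef := by
  have hent : ∀ i j, Tendsto (fun t => A t i j) l (𝓝 (B i j)) := fun i j =>
    tendsto_pi_nhds.1 (tendsto_pi_nhds.1 h i) j
  refine Matrix.PosSemidef.of_dotProduct_mulVec_nonneg ?_ fun v => ?_
  · ext i j
    refine tendsto_nhds_unique (hent j i) ((hent i j).congr' ?_)
    filter_upwards [hA] with t ht
    simpa using (ht.isHermitian.apply i j).symm
  · have : Tendsto (fun t => star v ⬝ᵥ (A t).mulVec v) l (𝓝 (star v ⬝ᵥ B.mulVec v)) := by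
      simp only [dotProduct, Matrix.mulVec]
      exact tendsto_finsetSum _ fun i _ => tendsto_const_nhds.mul
        (tendsto_finsetSum _ fun j _ => (hent i j).mul tendsto_const_nhds)
    exact ge_of_tendsto this (hA.mono fun t ht => ht.dotProduct_mulVec_nonneg v)

/-- A bordered matrix is nonsingular if the borders have full rank and the quadratic form is
definite on the kernel of the border. -/
theorem det_bordered_ne_zero {ι P Q : Type*} [Fintype ι] [DecidableEq ι] [Fintype P]
    [DecidableEq P] [Fintype Q] (A : Matrix ι P ℝ) (B : Matrix ι Q ℝ) {W : Matrix Q Q ℝ}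
    (hW : W.PosDef) (hA : ∀ v, A.mulVec v = 0 → v = 0)
    (hAB : ∀ u, A.transpose.mulVec u = 0 → B.transpose.mulVec u = 0 → u = 0) :
    (Matrix.fromBlocks (B * W * B.transpose) A A.transpose (0 : Matrix P P ℝ)).det ≠ 0 := by
  intro h0
  obtain ⟨w, hw, hw0⟩ := Matrix.exists_mulVec_eq_zero_iff.2 h0
  obtain ⟨u, v, rfl⟩ : ∃ u v, w = Sum.elim u v := ⟨_, _, (Sum.elim_comp_inl_inr w).symm⟩
  rw [Matrix.fromBlocks_mulVec] at hw0
  have e1 : (B * W * B.transpose).mulVec u + A.mulVec v = 0 := by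
    funext i; simpa using congrFun hw0 (Sum.inl i)
  have e2 : A.transpose.mulVec u = 0 := by
    funext i; simpa using congrFun hw0 (Sum.inr i)
  -- Pairing the first block equation with `u` kills `A v`, since `Aᵀ u = 0`, and leaves only the
  -- quadratic form of `W` at `Bᵀ u`.
  have e3 : (B.transpose.mulVec u) ⬝ᵥ W.mulVec (B.transpose.mulVec u) = 0 := by
    have h := congrArg (fun z => u ⬝ᵥ z) e1
    simp only [dotProduct_add, dotProduct_zero] at h
    rw [Matrix.dotProduct_mulVec u A, ← Matrix.mulVec_transpose, e2, zero_dotProduct, add_zero,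
      ← Matrix.mulVec_mulVec, ← Matrix.mulVec_mulVec, Matrix.dotProduct_mulVec u B,
      ← Matrix.mulVec_transpose] at h
    exact h
  have e4 : B.transpose.mulVec u = 0 := by
    by_contra hne
    exact (hW.dotProduct_mulVec_pos hne).ne' e3
  have e5 : u = 0 := hAB u e2 e4
  have e6 : v = 0 := hA v (by simpa [e5] using e1)
  exact hw (by funext i; cases i <;> simp [e5, e6])

/-! ### Unisolvent points and selection of rows -/

/-- If the vectors of monomial values did not span, a nonzero functional would annihilate them all.
Its coefficients define a polynomial vanishing on `ℝ^d`, hence zero, and distinct exponents make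
every coefficient zero. Finitely many points thus span, and the columns of `M` express the basis
vectors through them. -/
theorem exists_unisolvent_points {ι : Type*} [Fintype ι] [DecidableEq ι] (e : ι → Fin d → ℕ)
    (he : Function.Injective e) :
    ∃ (N : ℕ) (z : Fin N → EuclideanSpace ℝ (Fin d)) (M : Matrix (Fin N) ι ℝ),
      (Matrix.of fun a i => ∏ j, z a j ^ e i j).transpose * M = 1 := by
  let φ : EuclideanSpace ℝ (Fin d) → ι → ℝ := fun z i => ∏ j, z j ^ e i j
  have hspan : Submodule.span ℝ (Set.range φ) = ⊤ := by
    by_contra hne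
    obtain ⟨g, hg, hle⟩ := Submodule.exists_le_ker_of_lt_top _ (lt_top_iff_ne_top.2 hne)
    apply hg
    let p : MvPolynomial (Fin d) ℝ :=
      ∑ i, MvPolynomial.monomial (Finsupp.equivFunOnFinite.symm (e i)) (g (Pi.single i 1))
    have hp : p = 0 := by
      refine MvPolynomial.funext fun z => ?_
      have h1 : g (φ (WithLp.toLp 2 z)) = 0 := hle (Submodule.subset_span ⟨_, rfl⟩)
      rw [LinearMap.pi_apply_eq_sum_univ g] at h1
      simp only [p, map_sum, MvPolynomial.eval_monomial, map_zero]
      rw [← h1]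
      refine Finset.sum_congr rfl fun i _ => ?_
      rw [Finsupp.prod_fintype _ _ fun _ => pow_zero _, smul_eq_mul, mul_comm]
      congr 2
      funext j
      simp [Pi.single_apply, eq_comm]
    refine LinearMap.pi_ext' fun i => LinearMap.ext_ring ?_
    have h2 := congrArg (MvPolynomial.coeff (Finsupp.equivFunOnFinite.symm (e i))) hp
    simp only [p, MvPolynomial.coeff_sum, MvPolynomial.coeff_monomial, MvPolynomial.coeff_zero,
      EmbeddingLike.apply_eq_iff_eq, he.eq_iff] at h2
    simpa using h2
  obtain ⟨g, hg, hgs, -⟩ := Submodule.exists_fun_fin_finrank_span_eq ℝ (Set.range φ)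
  choose z hz using hg
  replace hgs := hgs.trans hspan
  have hM : ∀ i : ι, ∃ c : Fin _ → ℝ, ∑ a, c a • g a = Pi.single i 1 := fun i =>
    (Submodule.mem_span_range_iff_exists_fun ℝ).1 (hgs ▸ Submodule.mem_top)
  choose c hc using hM
  refine ⟨_, z, Matrix.of fun a i => c i a, ?_⟩
  ext i i'
  have h := congrFun (hc i') i
  simp only [← hz, Finset.sum_apply, Pi.smul_apply, smul_eq_mul] at h
  rw [Matrix.mul_apply]
  simp only [Matrix.transpose_apply, Matrix.of_apply, Matrix.one_apply]
  rw [Pi.single_apply] at h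
  rw [← h]
  exact Finset.sum_congr rfl fun a _ => mul_comm _ _

/-- If `A` has full column rank and `[A B]` has rank at least `m`, then some `m` rows of `[A B]`
are independent while the corresponding rows of `A` still have full column rank. -/
theorem exists_row_selection {ι P Q : Type*} [Fintype ι] [DecidableEq ι] [Fintype P] [Fintype Q]
    (A : Matrix ι P ℝ) (B : Matrix ι Q ℝ) (hA : LinearIndependent ℝ A.col) {m : ℕ}
    (hP : Fintype.card P ≤ m) (hm : m ≤ (Matrix.fromCols A B).rank) :
    ∃ X : Finset ι, X.card = m ∧
      (∀ v, (A.submatrix (Subtype.val : X → ι) id).mulVec v = 0 → v = 0) ∧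
      ∀ u, (A.submatrix (Subtype.val : X → ι) id).transpose.mulVec u = 0 →
        (B.submatrix (Subtype.val : X → ι) id).transpose.mulVec u = 0 → u = 0 := by
  classical
  -- A row basis `b₀` of `A` stays independent after appending `B` and extends to a row basis `b` of
  -- `[A B]`. Since `|b₀| ≤ |P| ≤ m ≤ |b|`, some `X` of size `m` lies between: containing `b₀` gives
  -- full column rank of `A_X`, lying in `b` gives independent rows.
  obtain ⟨b₀, -, -, hb₀s, hb₀⟩ := exists_linearIndepOn_extension (K := ℝ) (v := A.row)
    (linearIndepOn_empty ℝ A.row) (Set.empty_subset Set.univ)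
  have hb₀' : LinearIndepOn ℝ (Matrix.fromCols A B).row b₀ := by
    let π : (P ⊕ Q → ℝ) →ₗ[ℝ] (P → ℝ) := LinearMap.funLeft ℝ ℝ Sum.inl
    refine LinearIndependent.of_comp π ?_
    exact hb₀
  obtain ⟨b, -, hbb, hbs, hb⟩ := exists_linearIndepOn_extension hb₀' (Set.subset_univ b₀)
  have hb₀c : b₀.toFinset.card ≤ Fintype.card P := by
    have := LinearIndependent.fintype_card_le_finrank hb₀
    simpa [Set.toFinset_card] using this
  have hbc : m ≤ b.toFinset.card := by
    have h1 : (Matrix.fromCols A B).rank ≤ (b.toFinset.image (Matrix.fromCols A B).row).card := by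
      rw [Matrix.rank_eq_finrank_span_row]
      refine le_trans (Submodule.finrank_mono (t := Submodule.span ℝ
        ((b.toFinset.image (Matrix.fromCols A B).row : Finset _) : Set (P ⊕ Q → ℝ))) ?_)
        (finrank_span_finset_le_card _)
      rw [Submodule.span_le]
      simpa using hbs
    exact hm.trans (h1.trans Finset.card_image_le)
  obtain ⟨X, hX₀, hXb, hXm⟩ := Finset.exists_subsuperset_card_eq
    (Set.toFinset_subset_toFinset.2 hbb) (hb₀c.trans hP) hbc
  refine ⟨X, hXm, fun v hv => ?_, fun u hu hu' => ?_⟩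
  · have hz : ∀ i, A.row i ⬝ᵥ v = 0 := by
      intro i
      let g : (P → ℝ) →ₗ[ℝ] ℝ := (dotProductBilin ℝ ℝ).flip v
      have hker : Submodule.span ℝ (A.row '' b₀) ≤ LinearMap.ker g := by
        rw [Submodule.span_le]
        rintro _ ⟨i, hi, rfl⟩
        exact congrFun hv ⟨i, hX₀ (Set.mem_toFinset.2 hi)⟩
      exact hker (hb₀s ⟨i, Set.mem_univ i, rfl⟩)
    have hz' : A.mulVec v = 0 := funext hz
    exact Matrix.mulVec_injective_iff.2 hA (hz'.trans (Matrix.mulVec_zero A).symm)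
  · have hX : LinearIndepOn ℝ (Matrix.fromCols A B).row (X : Set ι) :=
      hb.mono fun i hi => Set.mem_toFinset.1 (hXb hi)
    have h2 := Fintype.linearIndependent_iff.1 hX u (by
      funext c
      rcases c with c | c
      · have := congrFun hu c
        simpa [Matrix.mulVec, dotProduct, mul_comm, Finset.sum_apply] using this
      · have := congrFun hu' c
        simpa [Matrix.mulVec, dotProduct, mul_comm, Finset.sum_apply] using this)
    exact funext h2

/-- The slack exponent `j - |α|` turns degree at most `j` in `d` variables into degree exactly `j`
in `d + 1` variables, counted by multisets. -/
theorem card_multiLT_le (d k : ℕ) : Fintype.card (MultiLT d k) ≤ polyDimLT d k := by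
  cases k with
  | zero =>
    have : IsEmpty (MultiLT d 0) := ⟨fun α => absurd α.2 (by lia)⟩
    simp [Fintype.card_eq_zero]
  | succ j =>
    have e := Sym.equivNatSumOfFintype (Fin (d + 1)) j
    let F : MultiLT d (j + 1) → {P : Fin (d + 1) → ℕ // ∑ i, P i = j} := fun α =>
      ⟨Fin.cons (j - ∑ i, α.1 i) α.1, by
        rw [Fin.sum_univ_succ]
        simp only [Fin.cons_zero, Fin.cons_succ]
        have := α.2
        lia⟩
    have hF : Function.Injective F := by
      intro α β h
      refine Subtype.ext (funext fun i => ?_)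
      simpa [F] using congrFun (congrArg Subtype.val h) i.succ
    have h1 : Fintype.card (MultiLT d (j + 1)) ≤ Fintype.card (Sym (Fin (d + 1)) j) :=
      Fintype.card_le_of_injective (fun α => e.symm (F α)) (e.symm.injective.comp hF)
    rw [Sym.card_sym_eq_choose, Fintype.card_fin] at h1
    refine h1.trans ?_
    rw [polyDimLT, show d + 1 + j - 1 = j + d by lia, Nat.choose_symm_add]

/-! ### Flat limits of the kernel matrix -/

/-- The diagonal matrix of the powers `ε^(k - |α|)`, `|α| < k`. -/
noncomputable def coscaling (d k : ℕ) (ε : ℝ) : Matrix (MultiLT d k) (MultiLT d k) ℝ :=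
  Matrix.diagonal fun α => ε ^ (k - ∑ i, α.1 i)

theorem scaling_mul_coscaling (d k : ℕ) (ε : ℝ) :
    scaling d k ε * coscaling d k ε = ε ^ k • 1 := by
  rw [scaling, coscaling, Matrix.diagonal_mul_diagonal, Matrix.smul_one_eq_diagonal]
  congr 1
  funext α
  rw [← pow_add, Nat.add_sub_cancel' α.2.le]

theorem coscaling_mul_scaling (d k : ℕ) (ε : ℝ) :
    coscaling d k ε * scaling d k ε = ε ^ k • 1 := by
  rw [← scaling_mul_coscaling, scaling, coscaling, Matrix.diagonal_mul_diagonal,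
    Matrix.diagonal_mul_diagonal]
  simp only [mul_comm]

theorem transpose_scaling (d k : ℕ) (ε : ℝ) : (scaling d k ε).transpose = scaling d k ε :=
  Matrix.diagonal_transpose _

theorem coscaling_zero (d k : ℕ) : coscaling d k 0 = 0 := by
  rw [coscaling, ← Matrix.diagonal_zero]
  congr 1
  funext α
  have := α.2
  exact zero_pow (by lia)

theorem continuous_coscaling (d k : ℕ) : Continuous (coscaling d k) := by
  unfold coscaling
  exact Continuous.matrix_diagonal (by fun_prop)

theorem det_coscaling_pos (d k : ℕ) {ε : ℝ} (hε : 0 < ε) : 0 < (coscaling d k ε).det := by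
  rw [coscaling, Matrix.det_diagonal]
  exact Finset.prod_pos fun α _ => pow_pos hε _

theorem posSemidef_kernelMatrix {κ : EuclideanSpace ℝ (Fin d) → EuclideanSpace ℝ (Fin d) → ℝ}
    {f : ℝ → ℝ} (hκ : IsStationaryKernel κ f) {n : ℕ} (x : Fin n → EuclideanSpace ℝ (Fin d))
    (ε : ℝ) : (kernelMatrix κ x ε).PosSemidef :=
  hκ.posDef n fun i => ε • x i

theorem principalMinor_kernelMatrix_nonneg
    {κ : EuclideanSpace ℝ (Fin d) → EuclideanSpace ℝ (Fin d) → ℝ}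
    {f : ℝ → ℝ} (hκ : IsStationaryKernel κ f) {n : ℕ} (x : Fin n → EuclideanSpace ℝ (Fin d))
    (ε : ℝ) (X : Finset (Fin n)) : 0 ≤ principalMinor (kernelMatrix κ x ε) X :=
  ((posSemidef_kernelMatrix hκ x ε).submatrix _).det_nonneg

/-- On unisolvent points the columns of `M₁` and `M₂` are dual to the monomials of degree below `k`
and equal to `k`. Rescaling `M₁` by the coscaling puts all blocks at the common order `ε^(2k)`, so
`ε^(-2k) [Y M₂]ᵀ L_ε [Y M₂]` is positive semi-definite and tends to the Wronskian. -/
theorem posSemidef_wronskian_blocks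
    {κ : EuclideanSpace ℝ (Fin d) → EuclideanSpace ℝ (Fin d) → ℝ}
    {f : ℝ → ℝ} (hκ : IsStationaryKernel κ f) {k : ℕ} (hk : (k : ℕ∞) < smoothnessOrder f) :
    (Matrix.fromBlocks (wronskianLT κ k) (wronskianTopRight κ k) (wronskianBottomLeft κ k)
      (wronskianBottomRight κ k)).PosSemidef := by
  obtain ⟨N, z, M, hM⟩ := exists_unisolvent_points (d := d)
    (Sum.elim Subtype.val Subtype.val : MultiLT d k ⊕ MultiEq d k → Fin d → ℕ)
    (Subtype.val_injective.sumElim Subtype.val_injective fun α β h => by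
      have h1 := α.2
      have h2 := β.2
      rw [h] at h1
      lia)
  set A := vandermondeLT z k
  set B := vandermondeEq z k
  have hAB : (Matrix.of fun a i => ∏ j, z a j ^ (Sum.elim Subtype.val Subtype.val :
      MultiLT d k ⊕ MultiEq d k → Fin d → ℕ) i j) = Matrix.fromCols A B := by
    ext a (i | i) <;> rfl
  obtain ⟨M₁, M₂, rfl⟩ : ∃ M₁ M₂, M = Matrix.fromCols M₁ M₂ :=
    ⟨_, _, (Matrix.fromCols_toCols M).symm⟩
  rw [hAB, Matrix.transpose_fromCols, Matrix.fromRows_mul_fromCols, ← Matrix.fromBlocks_one,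
    Matrix.fromBlocks_inj] at hM
  obtain ⟨h11, h12, h21, h22⟩ := hM
  obtain ⟨C, C', R, hC, hC', hR, hL⟩ := exists_kernelMatrix_expansion hκ hk z
  have hE := (continuous_coscaling d k).continuousAt (x := 0)
  let Y : ℝ → Matrix (Fin N) (MultiLT d k) ℝ := fun ε => M₁ * coscaling d k ε
  have hY : ContinuousAt Y 0 := continuousAt_matrix_mul continuousAt_const hE
  have hYt : ContinuousAt (fun ε => (Y ε).transpose) 0 :=
    ContinuousAt.comp (g := Matrix.transpose) (by fun_prop) hY
  let H : ℝ → Matrix (MultiLT d k ⊕ MultiEq d k) (MultiLT d k ⊕ MultiEq d k) ℝ := fun ε =>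
    Matrix.fromBlocks
      (wronskianLT κ k + ε • (C ε * Y ε + (Y ε).transpose * C' ε + (Y ε).transpose * R ε * Y ε))
      (wronskianTopRight κ k + ε • (C ε * M₂ + (Y ε).transpose * R ε * M₂))
      (wronskianBottomLeft κ k + ε • (M₂.transpose * C' ε + M₂.transpose * R ε * Y ε))
      (wronskianBottomRight κ k + ε • (M₂.transpose * R ε * M₂))
  have hH : ContinuousAt H 0 := by
    have c1 := continuousAt_matrix_mul hC hY
    have c2 := continuousAt_matrix_mul hYt hC'
    have c3 := continuousAt_matrix_mul hYt hR
    have c4 := continuousAt_matrix_mul c3 hY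
    have c5 := continuousAt_matrix_mul hC (continuousAt_const (y := M₂))
    have c6 := continuousAt_matrix_mul c3 (continuousAt_const (y := M₂))
    have c7 := continuousAt_matrix_mul (continuousAt_const (y := M₂.transpose)) hC'
    have c8 := continuousAt_matrix_mul (continuousAt_const (y := M₂.transpose)) hR
    have c9 := continuousAt_matrix_mul c8 hY
    have c10 := continuousAt_matrix_mul c8 (continuousAt_const (y := M₂))
    exact continuousAt_fromBlocks
      (continuousAt_const.add (continuousAt_id.smul ((c1.add c2).add c4)))
      (continuousAt_const.add (continuousAt_id.smul (c5.add c6)))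
      (continuousAt_const.add (continuousAt_id.smul (c7.add c9)))
      (continuousAt_const.add (continuousAt_id.smul c10))
  have hH0 : H 0 = Matrix.fromBlocks (wronskianLT κ k) (wronskianTopRight κ k)
      (wronskianBottomLeft κ k) (wronskianBottomRight κ k) := by
    simp [H]
  rw [← hH0]
  refine posSemidef_of_tendsto (l := 𝓝[>] 0)
    (hH.tendsto.mono_left nhdsWithin_le_nhds) ?_
  filter_upwards [self_mem_nhdsWithin] with ε hε
  have hε : 0 < ε := hε
  have key : (Matrix.fromCols (Y ε) M₂).transpose * kernelMatrix κ z ε *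
      Matrix.fromCols (Y ε) M₂ = ε ^ (2 * k) • H ε := by
    have a1 : (A * scaling d k ε).transpose * Y ε = ε ^ k • 1 := by
      simp only [Y]
      rw [Matrix.transpose_mul, Matrix.mul_assoc, ← Matrix.mul_assoc A.transpose, h11,
        Matrix.one_mul, transpose_scaling, scaling_mul_coscaling]
    have a2 : (A * scaling d k ε).transpose * M₂ = 0 := by
      rw [Matrix.transpose_mul, Matrix.mul_assoc, h12, Matrix.mul_zero]
    have a3 : (Y ε).transpose * (A * scaling d k ε) = ε ^ k • 1 := by
      have := congrArg Matrix.transpose a1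
      simpa [Matrix.transpose_mul] using this
    have a4 : M₂.transpose * (A * scaling d k ε) = 0 := by
      have := congrArg Matrix.transpose a2
      simpa [Matrix.transpose_mul] using this
    have b1 : B.transpose * Y ε = 0 := by
      simp only [Y]
      rw [← Matrix.mul_assoc, h21, Matrix.zero_mul]
    have b3 : (Y ε).transpose * B = 0 := by
      have := congrArg Matrix.transpose b1
      simpa [Matrix.transpose_mul] using this
    have b4 : M₂.transpose * B = 1 := by
      have := congrArg Matrix.transpose h22
      simpa [Matrix.transpose_mul] using this
    rw [hL ε hε, show vandermondeEq z k = B from rfl, Matrix.transpose_fromCols,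
      Matrix.fromRows_mul, Matrix.fromRows_mul_fromCols, Matrix.fromBlocks_smul]
    generalize A * scaling d k ε = G at *
    generalize Y ε = y at *
    generalize C ε = c at *
    generalize C' ε = c' at *
    generalize R ε = ρ at *
    generalize B = b at *
    -- Stated for arbitrary outer factors so that the duality relations can be substituted in each
    -- of the four blocks.
    have pull : ∀ {l : Type} (T : Matrix l (Fin N) ℝ) {r : Type} (S : Matrix (Fin N) r ℝ),
        T * (G * wronskianLT κ k * G.transpose +
          ε ^ k • (G * (wronskianTopRight κ k * b.transpose + ε • c)) +
          ε ^ k • ((b * wronskianBottomLeft κ k + ε • c') * G.transpose) +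
          ε ^ (2 * k) • (b * wronskianBottomRight κ k * b.transpose + ε • ρ)) * S =
        (T * G) * wronskianLT κ k * (G.transpose * S) +
          ε ^ k • ((T * G) * (wronskianTopRight κ k * (b.transpose * S) + ε • (c * S))) +
          ε ^ k • (((T * b) * wronskianBottomLeft κ k + ε • (T * c')) * (G.transpose * S)) +
          ε ^ (2 * k) • ((T * b) * wronskianBottomRight κ k * (b.transpose * S) +
            ε • (T * ρ * S)) := by
      intro l T r S
      simp only [Matrix.mul_add, Matrix.add_mul, Matrix.mul_smul, Matrix.smul_mul,
        Matrix.mul_assoc]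
    congr 1
    · rw [pull, a1, a3, b1, b3, two_mul, pow_add]
      simp only [Matrix.smul_mul, Matrix.mul_smul, Matrix.one_mul, Matrix.mul_one,
        Matrix.zero_mul, Matrix.mul_zero, zero_add]
      module
    · rw [pull, a2, a3, b3, h22, two_mul, pow_add]
      simp only [Matrix.smul_mul, Matrix.one_mul, Matrix.mul_one,
        Matrix.zero_mul, Matrix.mul_zero, zero_add]
      module
    · rw [pull, a1, a4, b1, b4, two_mul, pow_add]
      simp only [Matrix.mul_smul, Matrix.one_mul, Matrix.mul_one,
        Matrix.zero_mul, Matrix.mul_zero, zero_add]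
      module
    · rw [pull, a2, a4, b4, h22]
      simp only [Matrix.one_mul, Matrix.mul_one,
        Matrix.zero_mul, Matrix.mul_zero, zero_add, smul_zero]
  have hpos : (0 : ℝ) < ε ^ (2 * k) := pow_pos hε _
  have : H ε = (ε ^ (2 * k))⁻¹ • ((Matrix.fromCols (Y ε) M₂).transpose * kernelMatrix κ z ε *
      Matrix.fromCols (Y ε) M₂) := by
    rw [key, smul_smul, inv_mul_cancel₀ hpos.ne', one_smul]
  rw [this]
  refine Matrix.PosSemidef.smul ?_ (inv_nonneg.2 hpos.le)
  simpa using (posSemidef_kernelMatrix hκ z ε).conjTranspose_mul_mul_same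
    (Matrix.fromCols (Y ε) M₂)

/-- The bordered determinant is continuous at `ε = 0`, where the coscaling vanishes and the Schur
complement of the Wronskian appears in the upper left block. The normalising factor depends on `X`
only through its cardinality. -/
theorem tendsto_principalMinor_kernelMatrix
    {κ : EuclideanSpace ℝ (Fin d) → EuclideanSpace ℝ (Fin d) → ℝ}
    {f : ℝ → ℝ} (hκ : IsStationaryKernel κ f) {k : ℕ} (hk : (k : ℕ∞) < smoothnessOrder f)
    {n : ℕ} (x : Fin n → EuclideanSpace ℝ (Fin d)) (hW : IsUnit (wronskianLT κ k).det)
    (X : Finset (Fin n)) :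
    Tendsto (fun ε => principalMinor (kernelMatrix κ x ε) X *
        ((coscaling d k ε).det ^ 2 / ((ε ^ k) ^ 2) ^ X.card)) (𝓝[>] 0)
      (𝓝 ((wronskianLT κ k).det *
        extendedWeight (limitMatrix κ x k) (vandermondeLT x k) X)) := by
  obtain ⟨C, C', R, hC, hC', hR, hL⟩ := exists_kernelMatrix_expansion hκ hk x
  let ι : X → Fin n := Subtype.val
  set W := wronskianLT κ k with hWdef
  set A : Matrix X (MultiLT d k) ℝ := (vandermondeLT x k).submatrix ι id with hA
  set B : Matrix X (MultiEq d k) ℝ := (vandermondeEq x k).submatrix ι id with hB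
  let U : ℝ → Matrix (MultiLT d k) X ℝ := fun ε =>
    wronskianTopRight κ k * B.transpose + ε • (C ε).submatrix id ι
  let U' : ℝ → Matrix X (MultiLT d k) ℝ := fun ε =>
    B * wronskianBottomLeft κ k + ε • (C' ε).submatrix ι id
  let S : ℝ → Matrix X X ℝ := fun ε =>
    B * wronskianBottomRight κ k * B.transpose + ε • (R ε).submatrix ι ι
  have hU : ContinuousAt U 0 := continuousAt_const.add (continuousAt_id.smul
    (ContinuousAt.comp (g := fun M : Matrix (MultiLT d k) (Fin n) ℝ => M.submatrix id ι)
      (by fun_prop) hC))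
  have hU' : ContinuousAt U' 0 := continuousAt_const.add (continuousAt_id.smul
    (ContinuousAt.comp (g := fun M : Matrix (Fin n) (MultiLT d k) ℝ => M.submatrix ι id)
      (by fun_prop) hC'))
  have hS : ContinuousAt S 0 := continuousAt_const.add (continuousAt_id.smul
    (ContinuousAt.comp (g := fun M : Matrix (Fin n) (Fin n) ℝ => M.submatrix ι ι)
      (by fun_prop) hR))
  have hE := (continuous_coscaling d k).continuousAt (x := 0)
  let g : ℝ → ℝ := fun ε => (-1) ^ Fintype.card (MultiLT d k) * W.det *
    (Matrix.fromBlocks (S ε - U' ε * W⁻¹ * U ε) (A + U' ε * W⁻¹ * coscaling d k ε)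
      (A.transpose + coscaling d k ε * W⁻¹ * U ε)
      (-(coscaling d k ε * W⁻¹ * coscaling d k ε))).det
  have hg : ContinuousAt g 0 := by
    have c1 := continuousAt_matrix_mul hU' (continuousAt_const (y := W⁻¹))
    have c2 := continuousAt_matrix_mul hE (continuousAt_const (y := W⁻¹))
    refine continuousAt_const.mul (continuousAt_matrix_det (continuousAt_fromBlocks ?_ ?_ ?_ ?_))
    · exact hS.sub (continuousAt_matrix_mul c1 hU)
    · exact continuousAt_const.add (continuousAt_matrix_mul c1 hE)
    · exact continuousAt_const.add (continuousAt_matrix_mul c2 hU)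
    · exact (continuousAt_matrix_mul c2 hE).neg
  have hg0 : g 0 = W.det * extendedWeight (limitMatrix κ x k) (vandermondeLT x k) X := by
    have e : (limitMatrix κ x k).submatrix ι ι = S 0 - U' 0 * W⁻¹ * U 0 := by
      have : (limitMatrix κ x k).submatrix ι ι = B * wronskianSchur κ k * B.transpose := rfl
      rw [this, wronskianSchur]
      simp only [S, U, U', zero_smul, add_zero, Matrix.mul_sub, Matrix.sub_mul, Matrix.mul_assoc,
        hWdef]
    simp only [extendedWeight]
    rw [show (limitMatrix κ x k).submatrix (Subtype.val : X → Fin n) Subtype.val = _ from e]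
    simp only [g, coscaling_zero, Matrix.mul_zero, Matrix.zero_mul, add_zero, neg_zero]
    ring
  rw [← hg0]
  refine (hg.tendsto.mono_left nhdsWithin_le_nhds).congr' ?_
  filter_upwards [self_mem_nhdsWithin] with ε hε
  have hε : 0 < ε := hε
  have hsub : (kernelMatrix κ x ε).submatrix ι ι =
      (A * scaling d k ε) * W * (A * scaling d k ε).transpose + ε ^ k • ((A * scaling d k ε) * U ε)
        + ε ^ k • (U' ε * (A * scaling d k ε).transpose) + (ε ^ k) ^ 2 • S ε := by
    rw [hL ε hε, ← pow_mul, mul_comm k 2]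
    rfl
  have h := det_scaled_perturbation A W (scaling d k ε) (coscaling d k ε) (U ε) (U' ε) (S ε)
    (pow_pos hε k).ne' hW (scaling_mul_coscaling d k ε) (coscaling_mul_scaling d k ε)
    (transpose_scaling d k ε)
  rw [← hsub, Fintype.card_coe] at h
  change _ = ((kernelMatrix κ x ε).submatrix ι ι).det * _
  rw [← mul_div_assoc, h, mul_div_cancel_left₀ _ (by positivity)]

/-! ### The Schur complement and the extended L-ensemble -/

theorem posDef_wronskianLT {κ : EuclideanSpace ℝ (Fin d) → EuclideanSpace ℝ (Fin d) → ℝ}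
    {f : ℝ → ℝ} (hκ : IsStationaryKernel κ f) {k : ℕ} (hk : (k : ℕ∞) < smoothnessOrder f)
    (hW : IsUnit (wronskianLT κ k).det) : (wronskianLT κ k).PosDef :=
  ((posSemidef_wronskian_blocks hκ hk).submatrix Sum.inl).posDef_iff_det_ne_zero.2 hW.ne_zero

theorem posSemidef_wronskianSchur
    {κ : EuclideanSpace ℝ (Fin d) → EuclideanSpace ℝ (Fin d) → ℝ}
    {f : ℝ → ℝ} (hκ : IsStationaryKernel κ f) {k : ℕ} (hk : (k : ℕ∞) < smoothnessOrder f)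
    (hW : IsUnit (wronskianLT κ k).det) : (wronskianSchur κ k).PosSemidef := by
  have h := posSemidef_wronskian_blocks hκ hk
  -- Symmetry of the Wronskian is read off from semi-definiteness, with no interchange of
  -- derivatives.
  have h21 : wronskianBottomLeft κ k = (wronskianTopRight κ k).conjTranspose :=
    ((Matrix.isHermitian_fromBlocks_iff.1 h.isHermitian).2.1).symm
  let := Matrix.invertibleOfIsUnitDet _ hW
  rw [wronskianSchur, h21]
  rw [h21] at h
  exact (Matrix.PosDef.fromBlocks₁₁ _ _ (posDef_wronskianLT hκ hk hW)).1 h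

/-- Multi-indices of degree `≤ k` have degree `< k` or `= k`. -/
def multiSumEquiv (d k : ℕ) : MultiLT d k ⊕ MultiEq d k ≃ MultiLT d (k + 1) where
  toFun := Sum.elim (fun α => ⟨α.1, α.2.trans k.lt_succ_self⟩) fun α => ⟨α.1, by rw [α.2]; lia⟩
  invFun α := if h : ∑ i, α.1 i < k then Sum.inl ⟨α.1, h⟩ else Sum.inr ⟨α.1, by
    have := α.2; lia⟩
  left_inv := by
    rintro (α | α)
    · simp [α.2]
    · simp [α.2]
  right_inv α := by
    by_cases h : ∑ i, α.1 i < k <;> simp [h]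

/-- A semi-definite matrix is definite once its determinant is nonzero, and `det W_{≤k} = det
W_{≤k-1} · det W̄`. -/
theorem posDef_wronskianSchur
    {κ : EuclideanSpace ℝ (Fin d) → EuclideanSpace ℝ (Fin d) → ℝ}
    {f : ℝ → ℝ} (hκ : IsStationaryKernel κ f) {k : ℕ} (hk : (k : ℕ∞) < smoothnessOrder f)
    (hW : IsUnit (wronskianLT κ k).det) (hW' : IsUnit (wronskianLT κ (k + 1)).det) :
    (wronskianSchur κ k).PosDef := by
  rw [(posSemidef_wronskianSchur hκ hk hW).posDef_iff_det_ne_zero]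
  let := Matrix.invertibleOfIsUnitDet _ hW
  have e : (wronskianLT κ (k + 1)).submatrix (multiSumEquiv d k) (multiSumEquiv d k) =
      Matrix.fromBlocks (wronskianLT κ k) (wronskianTopRight κ k) (wronskianBottomLeft κ k)
        (wronskianBottomRight κ k) := by
    ext (i | i) (j | j) <;> rfl
  have h := Matrix.det_submatrix_equiv_self (multiSumEquiv d k) (wronskianLT κ (k + 1))
  rw [e, Matrix.det_fromBlocks₁₁, Matrix.invOf_eq_nonsing_inv] at h
  intro h0
  rw [show wronskianBottomRight κ k - wronskianBottomLeft κ k * (wronskianLT κ k)⁻¹ *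
    wronskianTopRight κ k = wronskianSchur κ k from rfl, h0, mul_zero] at h
  exact hW'.ne_zero h.symm

theorem isNonnegativePair_limitMatrix
    {κ : EuclideanSpace ℝ (Fin d) → EuclideanSpace ℝ (Fin d) → ℝ}
    {f : ℝ → ℝ} (hκ : IsStationaryKernel κ f) {k : ℕ} (hk : (k : ℕ∞) < smoothnessOrder f)
    {n : ℕ} (x : Fin n → EuclideanSpace ℝ (Fin d)) (hW : IsUnit (wronskianLT κ k).det)
    (hV : LinearIndependent ℝ (vandermondeLT x k).col) :
    IsNonnegativePair (limitMatrix κ x k) (vandermondeLT x k) := by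
  have h : (limitMatrix κ x k).PosSemidef := by
    simpa [limitMatrix] using
      (posSemidef_wronskianSchur hκ hk hW).mul_mul_conjTranspose_same (vandermondeEq x k)
  exact ⟨by simpa using h.isHermitian, fun v _ => by simpa using h.dotProduct_mulVec_nonneg v, hV⟩

/-- The sign is inherited in the limit: principal minors of a positive definite kernel are
nonnegative and `det W > 0`. -/
theorem extendedWeight_nonneg
    {κ : EuclideanSpace ℝ (Fin d) → EuclideanSpace ℝ (Fin d) → ℝ}
    {f : ℝ → ℝ} (hκ : IsStationaryKernel κ f) {k : ℕ} (hk : (k : ℕ∞) < smoothnessOrder f)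
    {n : ℕ} (x : Fin n → EuclideanSpace ℝ (Fin d)) (hW : IsUnit (wronskianLT κ k).det)
    (X : Finset (Fin n)) : 0 ≤ extendedWeight (limitMatrix κ x k) (vandermondeLT x k) X := by
  refine nonneg_of_mul_nonneg_right ?_ (posDef_wronskianLT hκ hk hW).det_pos
  refine ge_of_tendsto (tendsto_principalMinor_kernelMatrix hκ hk x hW X) ?_
  filter_upwards [self_mem_nhdsWithin] with ε hε
  have := principalMinor_kernelMatrix_nonneg hκ x ε X
  positivity

/-- All weights are nonnegative, so one set with nonzero weight suffices. Such a set is supplied by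
the row selection, `W̄` being definite. -/
theorem extendedNormaliser_ne_zero
    {κ : EuclideanSpace ℝ (Fin d) → EuclideanSpace ℝ (Fin d) → ℝ}
    {f : ℝ → ℝ} (hκ : IsStationaryKernel κ f) {k : ℕ} (hk : (k : ℕ∞) < smoothnessOrder f)
    {n : ℕ} (x : Fin n → EuclideanSpace ℝ (Fin d)) (hW : IsUnit (wronskianLT κ k).det)
    (hV : LinearIndependent ℝ (vandermondeLT x k).col) {m : ℕ} (hkm : polyDimLT d k ≤ m)
    (hW' : IsUnit (wronskianLT κ (k + 1)).det) (hm : m ≤ (vandermondeLT x (k + 1)).rank) :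
    extendedNormaliser (limitMatrix κ x k) (vandermondeLT x k) m ≠ 0 := by
  have hrank : (Matrix.fromCols (vandermondeLT x k) (vandermondeEq x k)).rank =
      (vandermondeLT x (k + 1)).rank := by
    rw [← Matrix.rank_submatrix (vandermondeLT x (k + 1)) (Equiv.refl (Fin n)) (multiSumEquiv d k)]
    congr 1
    ext i (j | j) <;> rfl
  obtain ⟨X, hXm, hX, hX'⟩ := exists_row_selection (vandermondeLT x k) (vandermondeEq x k) hV
    ((card_multiLT_le d k).trans hkm) (hm.trans hrank.ge)
  have hne : extendedWeight (limitMatrix κ x k) (vandermondeLT x k) X ≠ 0 :=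
    mul_ne_zero (pow_ne_zero _ (by norm_num))
      (det_bordered_ne_zero _ _ (posDef_wronskianSchur hκ hk hW hW') hX hX')
  refine (Finset.sum_pos' (fun Y _ => extendedWeight_nonneg hκ hk x hW Y) ⟨X, ?_, ?_⟩).ne'
  · simpa [Finset.mem_powersetCard] using hXm
  · exact lt_of_le_of_ne (extendedWeight_nonneg hκ hk x hW X) hne.symm

/-- Normalising nonnegative weights on the sets of size `m` gives a probability law. -/
theorem isPointProcessLaw_normalise {n m : ℕ} (w : Finset (Fin n) → ℝ) (hw : ∀ X, 0 ≤ w X)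
    (hZ : ∑ Y ∈ Finset.univ.powersetCard m, w Y ≠ 0) :
    IsPointProcessLaw fun X => if X.card = m then
      w X / ∑ Y ∈ Finset.univ.powersetCard m, w Y else 0 := by
  refine ⟨fun X => ?_, ?_⟩
  · dsimp only
    split_ifs
    · exact div_nonneg (hw X) (Finset.sum_nonneg fun Y _ => hw Y)
    · exact le_rfl
  · rw [← Finset.sum_filter, ← Finset.sum_div]
    rw [show (Finset.univ.filter fun X : Finset (Fin n) => X.card = m) =
      Finset.univ.powersetCard m by ext; simp [Finset.mem_powersetCard]]
    exact div_self hZ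

end FlatLimit

/-! ### Convergence of the fixed-size processes -/

theorem mainTheorem2 {d n : ℕ} (hd : 1 ≤ d)
    (κ : EuclideanSpace ℝ (Fin d) → EuclideanSpace ℝ (Fin d) → ℝ) (f : ℝ → ℝ)
    (hκ : IsStationaryKernel κ f)
    (x : Fin n → EuclideanSpace ℝ (Fin d))
    (k m : ℕ) (hkr : (k : ℕ∞) < smoothnessOrder f)
    (hkm : polyDimLT d k < m) (hmk : m ≤ polyDimLT d (k + 1))
    (hW : IsUnit (wronskianLT κ k).det)
    (hV : LinearIndependent ℝ (vandermondeLT x k).col) :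
    IsNonnegativePair (limitMatrix κ x k) (vandermondeLT x k) ∧
    (IsUnit (wronskianLT κ (k + 1)).det → m ≤ (vandermondeLT x (k + 1)).rank →
      extendedNormaliser (limitMatrix κ x k) (vandermondeLT x k) m ≠ 0) ∧
    (extendedNormaliser (limitMatrix κ x k) (vandermondeLT x k) m ≠ 0 →
      IsPointProcessLaw (fixedSizeExtendedLaw (limitMatrix κ x k) (vandermondeLT x k) m) ∧
      (∀ᶠ ε in 𝓝[>] (0 : ℝ), IsPointProcessLaw (fixedSizeLaw (kernelMatrix κ x ε) m)) ∧
      ∀ X : Finset (Fin n),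
        Tendsto (fun ε : ℝ => fixedSizeLaw (kernelMatrix κ x ε) m X) (𝓝[>] 0)
          (𝓝 (fixedSizeExtendedLaw (limitMatrix κ x k) (vandermondeLT x k) m X))) := by
  refine ⟨isNonnegativePair_limitMatrix hκ hkr x hW hV,
    fun hW' hm => extendedNormaliser_ne_zero hκ hkr x hW hV hkm.le hW' hm, fun hZ => ?_⟩
  have hlim := tendsto_principalMinor_kernelMatrix hκ hkr x hW
  -- All summands have size `m`, hence share one scaling factor, and the normaliser converges at the
  -- same rate as each minor.
  have hsum : Tendsto (fun ε => (∑ Y ∈ Finset.univ.powersetCard m,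
      principalMinor (kernelMatrix κ x ε) Y) *
        ((coscaling d k ε).det ^ 2 / ((ε ^ k) ^ 2) ^ m)) (𝓝[>] 0)
      (𝓝 ((wronskianLT κ k).det *
        extendedNormaliser (limitMatrix κ x k) (vandermondeLT x k) m)) := by
    simp only [extendedNormaliser, Finset.sum_mul, Finset.mul_sum]
    refine tendsto_finsetSum _ fun Y hY => ?_
    have := hlim Y
    rwa [(Finset.mem_powersetCard.1 hY).2] at this
  have hlim0 := mul_ne_zero hW.ne_zero hZ
  refine ⟨isPointProcessLaw_normalise _ (extendedWeight_nonneg hκ hkr x hW) hZ, ?_, fun X => ?_⟩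
  · filter_upwards [hsum.eventually_ne hlim0] with ε hε
    exact isPointProcessLaw_normalise _ (principalMinor_kernelMatrix_nonneg hκ x ε)
      (left_ne_zero_of_mul hε)
  · simp only [fixedSizeLaw, fixedSizeExtendedLaw]
    split_ifs with hX
    · subst hX
      -- In the quotient `det W` cancels from the limit, and the positive scaling factor cancels for
      -- each `ε > 0`.
      have h := (hlim X).div hsum hlim0
      rw [mul_div_mul_left _ _ hW.ne_zero] at h
      refine h.congr' ?_
      filter_upwards [self_mem_nhdsWithin] with ε hε
      have hε : 0 < ε := hε
      have hc := det_coscaling_pos d k hε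
      exact mul_div_mul_right _ _ (by positivity)
    · exact tendsto_const_nhds
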